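/- All graphs are finite, simple and non-empty. For a graph $G$ and $\lambda\ge 0$ let $\mathcal M(G)$ and $\mathcal I(G)$ be the sets of matchings and of independent sets of $G$, put $Z^{\mathrm{match}}_G(\lambda)=\sum_{M\in\mathcal M(G)}\lambda^{|M|}$ and $Z^{\mathrm{ind}}_G(\lambda)=\sum_{I\in\mathcal I(G)}\lambda^{|I|}$, and define the occupancy fractions $$\alpha^{\mathrm{match}}_G(\lambda)=\frac{1}{|E(G)|}\sum_{M\in\mathcal M(G)}|M|\,\frac{\lambda^{|M|}}{Z^{\mathrm{match}}_G(\lambda)},\qquad \alpha^{\mathrm{ind}}_G(\lambda)=\frac{1}{|V(G)|}\sum_{I\in\mathcal I(G)}|I|\,\frac{\lambda^{|I|}}{Z^{\mathrm{ind}}_G(\lambda)}$$ (the former when $G$ has an edge). For $r\ge 1$ let $\rho_r(G)$ be the distribution of the isomorphism class of the rooted graph obtained by choosing a vertex $v$ of $G$ uniformly at random and taking the subgraph induced by the vertices at distance at most $r$ from $v$, rooted at $v$. The sampling distance of $G$ and $G'$ is $\delta_\circ(G,G')=\sum_{r=1}^\infty 2^{-r}\|\rho_r(G)-\rho_r(G')\|_{TV}$,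 where $\|\cdot\|_{TV}$ is the total variation distance. There exist functions $c^{\mathrm{match}}(d,\lambda)\ge 0$ and $c^{\mathrm{ind}}(d,\lambda)\ge 0$, defined for integers $d\ge 1$ and real $\lambda\ge 0$, continuous in $\lambda$ on $[0,\infty)$ and strictly positive for $\lambda>0$, such that for every $d\ge 1$, every $d$-regular graph $G$ and every $\lambda\ge 0$, $$\alpha^{\mathrm{match}}_G(\lambda)\le \alpha^{\mathrm{match}}_{K_{d,d}}(\lambda)-c^{\mathrm{match}}(d,\lambda)\,\delta_\circ(G,K_{d,d}),$$ $$\alpha^{\mathrm{ind}}_G(\lambda)\le \alpha^{\mathrm{ind}}_{K_{d,d}}(\lambda)-c^{\mathrm{ind}}(d,\lambda)\,\delta_\circ(G,K_{d,d}).$$ -/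

import Mathlib

noncomputable section

namespace OccStability

open scoped Classical

section Models

variable {V : Type*} [Fintype V]

/-- The set `𝓜(G)` of all matchings of `G`: sets of edges no two of which share a vertex. -/
def matchings (G : SimpleGraph V) : Finset (Finset (Sym2 V)) :=
  G.edgeFinset.powerset.filter fun M => ∀ e ∈ M, ∀ f ∈ M, ∀ v, v ∈ e → v ∈ f → e = f

/-- The set `𝓘(G)` of all independent sets of `G`. -/
def indepSets (G : SimpleGraph V) : Finset (Finset V) :=
  Finset.univ.filter fun I => G.IsIndepSet (I : Set V)

/-- The matching polynomial `Z^match_G(lam) = ∑_M lam^|M|`. -/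
def zMatch (G : SimpleGraph V) (lam : ℝ) : ℝ :=
  ∑ M ∈ matchings G, lam ^ M.card

/-- The independence polynomial `Z^ind_G(lam) = ∑_I lam^|I|`. -/
def zInd (G : SimpleGraph V) (lam : ℝ) : ℝ :=
  ∑ I ∈ indepSets G, lam ^ I.card

/-- The occupancy fraction of the monomer-dimer model at fugacity `lam`: the expected fraction of
edges in a random matching, where a matching `M` has probability `lam^|M| / Z^match_G(lam)`. -/
def alphaMatch (G : SimpleGraph V) (lam : ℝ) : ℝ :=
  1 / (G.edgeFinset.card : ℝ) *
    ∑ M ∈ matchings G, (M.card : ℝ) * (lam ^ M.card / zMatch G lam)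

/-- The occupancy fraction of the hard-core model at fugacity `lam`: the expected fraction of
vertices in a random independent set, where an independent set `I` has probability
`lam^|I| / Z^ind_G(lam)`. -/
def alphaInd (G : SimpleGraph V) (lam : ℝ) : ℝ :=
  1 / (Fintype.card V : ℝ) *
    ∑ I ∈ indepSets G, (I.card : ℝ) * (lam ^ I.card / zInd G lam)

end Models

section Sampling

/-- A finite rooted graph, on a vertex set `{0, …, n - 1}`. -/
structure RootedGraph where
  n : ℕ
  graph : SimpleGraph (Fin n)
  root : Fin n

/-- Isomorphism of rooted graphs: a graph isomorphism mapping root to root. -/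
def RootedGraph.Iso (A B : RootedGraph) : Prop :=
  ∃ φ : A.graph ≃g B.graph, φ A.root = B.root

/-- Rooted isomorphism is an equivalence relation. -/
instance rootedSetoid : Setoid RootedGraph where
  r := RootedGraph.Iso
  iseqv :=
    { refl := fun _ => ⟨SimpleGraph.Iso.refl, rfl⟩
      symm := fun ⟨φ, h⟩ => ⟨φ.symm, by rw [← h]; exact φ.symm_apply_apply _⟩
      trans := fun ⟨φ, h⟩ ⟨ψ, k⟩ => ⟨φ.trans ψ, by rw [← k, ← h]; rfl⟩ }

/-- Isomorphism classes of finite rooted graphs. -/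
def RootedClass : Type := Quotient rootedSetoid

/-- The isomorphism class of a graph `H` on a finite vertex set `W`, rooted at `w`
(it does not depend on the enumeration of `W` used here). -/
def rootedClass {W : Type*} [Fintype W] (H : SimpleGraph W) (w : W) : RootedClass :=
  Quotient.mk rootedSetoid
    { n := Fintype.card W
      graph := H.comap (Fintype.equivFin W).symm
      root := Fintype.equivFin W w }

variable {V : Type*} [Fintype V]

/-- The vertices at distance at most `r` from `v`. -/
def ballSet (G : SimpleGraph V) (r : ℕ) (v : V) : Set V :=
  {w | G.edist v w ≤ (r : ℕ∞)}

/-- The isomorphism class of the depth-`r` ball around `v`: the subgraph of `G` induced by the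
vertices at distance at most `r` from `v`, rooted at `v`. -/
def ballClass (G : SimpleGraph V) (r : ℕ) (v : V) : RootedClass :=
  rootedClass (G.induce (ballSet G r v)) ⟨v, by simp [ballSet]⟩

/-- The distribution `ρ_r(G)`: the probability that the depth-`r` ball around a uniformly random
vertex of `G` belongs to the class `c`. -/
def rho (r : ℕ) (G : SimpleGraph V) (c : RootedClass) : ℝ :=
  ((Finset.univ.filter fun v : V => ballClass G r v = c).card : ℝ) / (Fintype.card V : ℝ)

/-- Total variation distance of two (finitely supported) distributions on rooted graphs. -/
def tvDist (p q : RootedClass → ℝ) : ℝ :=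
  1 / 2 * ∑' c : RootedClass, |p c - q c|

/-- The sampling distance `δ_∘(G, G') = ∑_{r ≥ 1} 2^{-r} ‖ρ_r(G) - ρ_r(G')‖_TV`. -/
def samplingDist {V' : Type*} [Fintype V'] (G : SimpleGraph V) (G' : SimpleGraph V') : ℝ :=
  ∑' k : ℕ, (1 / 2 : ℝ) ^ (k + 1) * tvDist (rho (k + 1) G) (rho (k + 1) G')

end Sampling

/-- The complete bipartite graph `K_{d,d}`. -/
abbrev Kdd (d : ℕ) : SimpleGraph (Fin d ⊕ Fin d) := completeBipartiteGraph (Fin d) (Fin d)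

end OccStability

end

/-! In both models the deficit of `G` against `K_{d,d}` is, up to an explicit positive factor, a sum
over vertices of nonnegative local gaps. The gaps vanish throughout `K_{d,d}`, which gives the
extremal value. At a vertex violating `IsGood` the gap is at least a constant, depending on `d` and
the fugacity only, times the partition function. In a regular graph a good vertex lies in a
component isomorphic to `K_{d,d}`, so every ball around it looks as it does there, and the sampling
distance is at most the fraction of bad vertices (`samplingDist_le`).

Hard-core model: condition on the part `J` of the independent set outside the closed neighbourhood
of `v`. The sets of neighbours compatible with `J` form a down-closed family, and the mean size of a
nonempty member is largest for the full power set (`sizeGap_nonneg`). Summed over `J`, the gap is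
linear in the partition function and in the weights of the sets containing `v` or a given neighbour
of `v`; by regularity the sum over `v` involves only the occupancy fraction (`sum_indGap`).

Monomer-dimer model: this is linear programming duality. For a dart `uv` and a matching avoiding
both ends, let `a` and `b` count the free neighbours of `u` and of `v` (excluding each other) and
`c` the common ones. The partition function is a sum over such matchings of a polynomial in `a, b,
c`. Computing one sum in two ways gives a stationarity relation for every test function
(`sum_flow`). For the test function built from `potential`, the polynomial is a constant plus flow
terms plus `slack` (`local_identity`). The slack is nonnegative because the potential decreases, and
strict decrease makes it positive unless `a = b` and `c = 0`, which always holds in `K_{d,d}`.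

For the lower bounds, a bad vertex admits a boundary configuration on a bounded set that forces a
positive gap, and prescribing a configuration there costs only a bounded factor. -/

namespace OccStability

/-! ### The dual potential for matchings: strict decrease and continuity -/

/-- A solution of the first-order recursion attached to the monomer-dimer chain is strictly
increasing up to its last index. -/
theorem strictMono_of_recursion {n : ℕ} {lam m : ℝ} (hlam : 0 < lam) (hm : 0 < m)
    {g : ℕ → ℝ} (h0 : g 0 = 0)
    (hrec : ∀ a ≤ n, ((n : ℝ) - a) * (g (a + 1) / (a + 1)) = lam * (m - a) + lam * a * g a) :
    ∀ a < n, g a < g (a + 1) := by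
  -- Difference of the recursions at `k + 1` and at `k`. The case `k + 1 = n` is included: the
  -- left-hand coefficient is then zero.
  have second : ∀ k, k + 1 ≤ n → ((n : ℝ) - (k + 1)) / (k + 2) * (g (k + 2) - g (k + 1)) =
      (((n : ℝ) + 1) / ((k + 1) * (k + 2)) + lam) * g (k + 1)
        + lam * k * (g (k + 1) - g k) - lam := by
    intro k hk
    have h1 := hrec k (by omega)
    have h2 := hrec (k + 1) hk
    push_cast at h2
    have e1 : (k : ℝ) + 1 ≠ 0 := by positivity
    have e2 : (k : ℝ) + 2 ≠ 0 := by positivity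
    have e3 : (k : ℝ) + 1 + 1 = k + 2 := by ring
    rw [show k + 1 + 1 = k + 2 from rfl, e3] at h2
    have key : (((n : ℝ) + 1) / ((k + 1) * (k + 2))) * g (k + 1)
        = (n - k) * (g (k + 1) / (k + 1)) - ((n : ℝ) - (k + 1)) / (k + 2) * g (k + 1) := by
      field_simp
      ring
    have key2 : ((n : ℝ) - (k + 1)) / (k + 2) * g (k + 2)
        = (n - (k + 1)) * (g (k + 2) / (k + 2)) := by ring
    linear_combination key2 + h2 - h1 - key
  by_contra! hcon
  have hex : ∃ a, a < n ∧ g (a + 1) ≤ g a := hcon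
  classical
  obtain ⟨⟨hn, hle⟩, hmin⟩ := And.intro (Nat.find_spec hex) (fun b => Nat.find_min hex (m := b))
  generalize Nat.find hex = a at hn hle hmin
  have hnpos : 0 < n := by omega
  -- Once `g` fails to increase, the bracket in `second` stays below `lam`, since its coefficient
  -- strictly decreases in the index.
  have decay : ∀ i, i + 1 < n → g (i + 2) ≤ g (i + 1) →
      (((n : ℝ) + 1) / ((i + 1) * (i + 2)) + lam) * g (i + 1) ≤ lam →
      (((n : ℝ) + 1) / ((i + 2) * (i + 3)) + lam) * g (i + 2) < lam := by
    intro i _ h1 h2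
    rcases le_or_gt (g (i + 2)) 0 with h | h
    · have : 0 ≤ ((n : ℝ) + 1) / ((i + 2) * (i + 3)) + lam := by positivity
      nlinarith
    · have hlt : ((n : ℝ) + 1) / ((i + 2) * (i + 3)) < ((n : ℝ) + 1) / ((i + 1) * (i + 2)) := by
        apply div_lt_div_of_pos_left <;> first | positivity | nlinarith
      have : 0 < ((n : ℝ) + 1) / ((i + 2) * (i + 3)) + lam := by positivity
      nlinarith
  -- A first failure to increase propagates to the last index. There `second` reads `0 < 0`, because
  -- its leading coefficient vanishes; `j` is the distance to the end.
  have prop : ∀ j i, i + 1 + j = n → 0 < j → g (i + 2) ≤ g (i + 1) →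
      (((n : ℝ) + 1) / ((i + 1) * (i + 2)) + lam) * g (i + 1) ≤ lam → False := by
    intro j
    induction j with
    | zero => intro i _ h; omega
    | succ j ih =>
      intro i hi _ h1 h2
      have h3 := decay i (by omega) h1 h2
      have h4 := second (i + 1) (by omega)
      push_cast at h4
      rw [show (i : ℝ) + 1 + 1 = i + 2 by ring, show (i : ℝ) + 1 + 2 = i + 3 by ring,
        show i + 1 + 2 = i + 3 from rfl, show i + 1 + 1 = i + 2 from rfl] at h4
      have h5 : lam * ((i : ℝ) + 1) * (g (i + 2) - g (i + 1)) ≤ 0 :=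
        mul_nonpos_of_nonneg_of_nonpos (by positivity) (by linarith)
      have h6 : ((n : ℝ) - (i + 2)) / (i + 3) * (g (i + 3) - g (i + 2)) < 0 := by linarith
      have hni : (n : ℝ) = i + 1 + (j + 1) := by exact_mod_cast hi.symm
      rcases Nat.eq_zero_or_pos j with rfl | hj
      · rw [hni] at h6
        norm_num at h6
        ring_nf at h6
        exact lt_irrefl _ h6
      · refine ih (i + 1) (by omega) hj ?_ ?_
        · by_contra! hc
          have : 0 ≤ ((n : ℝ) - (i + 2)) / (i + 3) := by
            apply div_nonneg _ (by positivity)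
            rw [hni]; linarith [(Nat.cast_nonneg j : (0 : ℝ) ≤ j),
              (by exact_mod_cast hj : (1 : ℝ) ≤ j)]
          have := mul_nonneg this (sub_nonneg.2 hc.le)
          linarith
        · push_cast
          rw [show (i : ℝ) + 1 + 1 = i + 2 by ring, show (i : ℝ) + 1 + 2 = i + 3 by ring]
          exact h3.le
  rcases a with _ | k
  · have h := hrec 0 (by omega)
    simp only [zero_add, Nat.cast_zero] at h hle
    have hn' : (0 : ℝ) < n := by exact_mod_cast hnpos
    have : (n : ℝ) * g 1 = lam * m := by linarith
    rw [h0] at hle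
    nlinarith [mul_pos hlam hm]
  -- Minimality of the failure makes the middle term of `second` nonnegative, which yields the
  -- starting inequality for `prop`.
  · have hk : g k < g (k + 1) := by
      by_contra! hc
      exact hmin k (by omega) ⟨by omega, hc⟩
    have h := second k (by omega)
    have hcast : (k : ℝ) + 1 < n := by exact_mod_cast hn
    have h1 : ((n : ℝ) - (k + 1)) / (k + 2) * (g (k + 2) - g (k + 1)) ≤ 0 :=
      mul_nonpos_of_nonneg_of_nonpos (div_nonneg (by linarith) (by positivity))
        (sub_nonpos.2 hle)
    have h2 : 0 ≤ lam * k * (g (k + 1) - g k) :=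
      mul_nonneg (by positivity) (by linarith)
    exact prop (n - (k + 1)) k (by omega) (by omega) hle (by linarith)

noncomputable section

/-- Unnormalised law of the number of uncovered vertices on each side in the monomer-dimer model
on `K_{n,n}`. -/
def chainWeight (n : ℕ) (lam : ℝ) (s : ℕ) : ℝ := (n.choose s : ℝ) / (s.factorial * lam ^ s)

/-- The mean of the law with weights `chainWeight n lam`. -/
def chainMean (n : ℕ) (lam : ℝ) : ℝ :=
  (∑ s ∈ Finset.range (n + 1), (s : ℝ) * chainWeight n lam s) /
    ∑ s ∈ Finset.range (n + 1), chainWeight n lam s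

/-- The dual potential of the linear programme for matchings. -/
def potential (n : ℕ) (lam : ℝ) (a : ℕ) : ℝ :=
  (∑ s ∈ Finset.range a, chainWeight n lam s * (s - chainMean n lam)) / (a * chainWeight n lam a)

end

theorem chainWeight_pos {n s : ℕ} (hs : s ≤ n) {lam : ℝ} (hlam : 0 < lam) :
    0 < chainWeight n lam s := by
  have := Nat.choose_pos hs
  unfold chainWeight
  positivity

/-- Ratio of consecutive weights; it converts the partial sums defining `potential` into a
first-order recursion. -/
theorem chainWeight_succ {n s : ℕ} (hs : s < n) {lam : ℝ} (hlam : 0 < lam) :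
    lam * (s + 1) ^ 2 * chainWeight n lam (s + 1) = (n - s) * chainWeight n lam s := by
  have h : (n.choose (s + 1) : ℝ) * (s + 1) = n.choose s * (n - s) := by
    have := Nat.choose_succ_right_eq n s
    rw [← Nat.cast_sub hs.le]
    exact_mod_cast this
  have hf : ((s.factorial : ℕ) : ℝ) ≠ 0 := by positivity
  have hl := hlam.ne'
  have hs1 : (s : ℝ) + 1 ≠ 0 := by positivity
  unfold chainWeight
  rw [Nat.factorial_succ, pow_succ]
  push_cast
  field_simp
  linear_combination lam * lam ^ s * h

theorem sum_chainWeight_pos (n : ℕ) {lam : ℝ} (hlam : 0 < lam) :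
    0 < ∑ s ∈ Finset.range (n + 1), chainWeight n lam s :=
  Finset.sum_pos (fun s hs => chainWeight_pos (by simpa [Nat.lt_succ_iff] using hs) hlam) (by simp)

theorem chainMean_pos {n : ℕ} (hn : 0 < n) {lam : ℝ} (hlam : 0 < lam) : 0 < chainMean n lam := by
  refine div_pos ?_ (sum_chainWeight_pos n hlam)
  refine Finset.sum_pos' (fun s hs => ?_) ⟨n, by simp, ?_⟩
  · have := chainWeight_pos (n := n) (s := s) (by simpa [Nat.lt_succ_iff] using hs) hlam
    positivity
  · have := chainWeight_pos (le_refl n) hlam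
    positivity

@[simp] theorem potential_zero (n : ℕ) (lam : ℝ) : potential n lam 0 = 0 := by simp [potential]

theorem mul_potential {n a : ℕ} (ha : a ≤ n) {lam : ℝ} (hlam : 0 < lam) :
    a * potential n lam a * chainWeight n lam a =
      ∑ s ∈ Finset.range a, chainWeight n lam s * (s - chainMean n lam) := by
  rcases Nat.eq_zero_or_pos a with rfl | h
  · simp
  · have h1 := (chainWeight_pos ha hlam).ne'
    have h2 : (a : ℝ) ≠ 0 := by positivity
    unfold potential
    field_simp

/-- Adding one term to the partial sum in `mul_potential` and dividing by the weight gives the case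
`a < n`. The case `a = n` is the boundary condition that the full centred sum vanishes, which is
what the choice of `chainMean` as the mean provides. -/
theorem potential_rec {n a : ℕ} (ha : a ≤ n) {lam : ℝ} (hlam : 0 < lam) :
    ((n : ℝ) - a) * (potential n lam (a + 1) / (a + 1)) - lam * a * potential n lam a =
      lam * (a - chainMean n lam) := by
  have hw := chainWeight_pos ha hlam
  have h1 := mul_potential ha hlam
  rcases ha.eq_or_lt with rfl | hlt
  · have htot : ∑ s ∈ Finset.range (a + 1), chainWeight a lam s * (s - chainMean a lam) = 0 := by
      have hpos := sum_chainWeight_pos a hlam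
      simp only [mul_sub, Finset.sum_sub_distrib, ← Finset.sum_mul]
      unfold chainMean
      field_simp
      simp only [mul_comm, sub_self]
    rw [Finset.sum_range_succ, ← h1] at htot
    have : (a : ℝ) * potential a lam a + (a - chainMean a lam) = 0 := by
      have : chainWeight a lam a * (a * potential a lam a + (a - chainMean a lam)) = 0 := by
        linarith
      exact (mul_eq_zero.1 this).resolve_left hw.ne'
    linear_combination (-lam) * this
  · have h2 := mul_potential (Nat.succ_le_of_lt hlt) hlam
    rw [Nat.succ_eq_add_one, Finset.sum_range_succ, ← h1] at h2
    have h3 := chainWeight_succ hlt hlam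
    have hs1 : (a : ℝ) + 1 ≠ 0 := by positivity
    apply mul_right_cancel₀ hw.ne'
    push_cast at h2
    have h4 : potential n lam (a + 1) / (a + 1) * ((a : ℝ) + 1) = potential n lam (a + 1) := by
      field_simp
    generalize potential n lam (a + 1) / (a + 1) = p at h4 ⊢
    rw [← h4] at h2
    linear_combination lam * h2 - p * h3

/-- The dual potential is strictly decreasing. -/
theorem potential_succ_lt {n : ℕ} {lam : ℝ} (hlam : 0 < lam) {a : ℕ} (ha : a < n) :
    potential n lam (a + 1) < potential n lam a := by
  have := strictMono_of_recursion (n := n) hlam (chainMean_pos (by omega : 0 < n) hlam)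
    (g := fun a => -potential n lam a) (by simp)
    (fun a ha => by linear_combination - potential_rec ha hlam) a ha
  linarith

theorem continuousOn_chainWeight (n s : ℕ) :
    ContinuousOn (fun lam => chainWeight n lam s) (Set.Ioi 0) := by
  unfold chainWeight
  refine ContinuousOn.div (by fun_prop) (by fun_prop) fun x hx => ?_
  have : (0 : ℝ) < x := hx
  positivity

theorem continuousOn_chainMean (n : ℕ) : ContinuousOn (chainMean n) (Set.Ioi 0) := by
  unfold chainMean
  refine ContinuousOn.div ?_ ?_ fun x hx => (sum_chainWeight_pos n hx).ne'
  · exact continuousOn_finsetSum _ fun s _ => continuousOn_const.mul (continuousOn_chainWeight n s)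
  · exact continuousOn_finsetSum _ fun s _ => continuousOn_chainWeight n s

theorem continuousOn_potential {n a : ℕ} (ha : a ≤ n) :
    ContinuousOn (fun lam => potential n lam a) (Set.Ioi 0) := by
  rcases Nat.eq_zero_or_pos a with rfl | h
  · simpa using continuousOn_const
  unfold potential
  refine ContinuousOn.div ?_ (continuousOn_const.mul (continuousOn_chainWeight n a)) fun x hx => ?_
  · exact continuousOn_finsetSum _ fun s _ =>
      (continuousOn_chainWeight n s).mul (continuousOn_const.sub (continuousOn_chainMean n))
  · have := chainWeight_pos ha hx
    positivity

/-- Finitely many positive continuous functions on `(0, ∞)` have a positive continuous minorant. -/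
theorem exists_continuousOn_le (s : Finset ℕ) (D : ℕ → ℝ → ℝ)
    (hc : ∀ a ∈ s, ContinuousOn (D a) (Set.Ioi 0)) (hp : ∀ a ∈ s, ∀ x, 0 < x → 0 < D a x) :
    ∃ e : ℝ → ℝ, ContinuousOn e (Set.Ioi 0) ∧ (∀ x, 0 < x → 0 < e x) ∧
      ∀ a ∈ s, ∀ x, e x ≤ D a x := by
  classical
  induction s using Finset.induction_on with
  | empty => exact ⟨fun _ => 1, continuousOn_const, by simp, by simp⟩
  | insert a s _ ih =>
    obtain ⟨e, h1, h2, h3⟩ := ih (fun b hb => hc b (by simp [hb])) fun b hb => hp b (by simp [hb])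
    refine ⟨fun x => min (D a x) (e x), ContinuousOn.inf (hc a (by simp)) h1,
      fun x hx => lt_min (hp a (by simp) x hx) (h2 x hx), fun b hb x => ?_⟩
    rcases Finset.mem_insert.1 hb with rfl | hb
    · exact min_le_left _ _
    · exact (min_le_right _ _).trans (h3 b hb x)

/-- A lower bound for the decrements of the dual potential, continuous in the fugacity. -/
theorem exists_potential_gap (n : ℕ) : ∃ e : ℝ → ℝ, ContinuousOn e (Set.Ioi 0) ∧
    (∀ x, 0 < x → 0 < e x) ∧
      ∀ a < n, ∀ x, e x ≤ potential n x a - potential n x (a + 1) := by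
  obtain ⟨e, h1, h2, h3⟩ := exists_continuousOn_le (Finset.range n)
    (fun a x => potential n x a - potential n x (a + 1))
    (fun a ha => by
      rw [Finset.mem_range] at ha
      exact (continuousOn_potential ha.le).sub (continuousOn_potential ha))
    (fun a ha x hx => sub_pos.2 (potential_succ_lt hx (Finset.mem_range.1 ha)))
  exact ⟨e, h1, h2, fun a ha => h3 a (Finset.mem_range.2 ha)⟩

end OccStability

/-! ### Mean sizes in down-closed families -/

namespace OccStability

section DownClosed

variable {V : Type*}

open Finset

open scoped Finset

/-- Local LYM by double counting: send a member of level `j + 1` with a marked element to the set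
without that element, keeping the mark, which now lies in the complement. The map is injective and
stays in `F` by down-closure. -/
theorem mul_card_slice_succ_le {N : Finset V} {F : Finset (Finset V)}
    (hN : ∀ A ∈ F, A ⊆ N) (hF : ∀ A ∈ F, ∀ B ⊆ A, B ∈ F) (j : ℕ) :
    (j + 1) * (F # (j + 1)).card ≤ (N.card - j) * (F # j).card := by
  classical
  have h1 : ((F # (j + 1)).sigma fun A => A).card = (j + 1) * (F # (j + 1)).card := by
    rw [card_sigma, sum_congr rfl fun A hA => (mem_slice.1 hA).2, sum_const, smul_eq_mul, mul_comm]
  have h2 : ((F # j).sigma fun A => N \ A).card = (N.card - j) * (F # j).card := by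
    rw [card_sigma, sum_congr rfl fun A hA => (card_sdiff_of_subset (hN A (mem_slice.1 hA).1)).trans
      (by rw [(mem_slice.1 hA).2]), sum_const, smul_eq_mul, mul_comm]
  rw [← h1, ← h2]
  refine card_le_card_of_injOn (fun p => ⟨p.1.erase p.2, p.2⟩) ?_ ?_
  · rintro ⟨A, x⟩ hp
    simp only [coe_sigma, Set.mem_sigma_iff, mem_coe, mem_slice] at hp
    simp only [coe_sigma, Set.mem_sigma_iff, mem_coe, mem_slice, mem_sdiff, mem_erase]
    refine ⟨⟨hF A hp.1.1 _ (erase_subset _ _), ?_⟩, hN A hp.1.1 hp.2, by simp⟩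
    rw [card_erase_of_mem hp.2, hp.1.2]; simp
  · rintro ⟨A, x⟩ hp ⟨B, y⟩ hq h
    simp only [coe_sigma, Set.mem_sigma_iff, mem_coe] at hp hq
    simp only [Sigma.mk.injEq, heq_eq_eq] at h
    obtain ⟨h, rfl⟩ := h
    rw [← insert_erase hp.2, ← insert_erase hq.2, h]

/-- In a down-closed family the normalised level sizes are nonincreasing. -/
theorem card_slice_mul_choose_le {N : Finset V} {F : Finset (Finset V)}
    (hN : ∀ A ∈ F, A ⊆ N) (hF : ∀ A ∈ F, ∀ B ⊆ A, B ∈ F) {j k : ℕ} (hjk : j ≤ k)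
    (hk : k ≤ N.card) :
    (F # k).card * N.card.choose j ≤ (F # j).card * N.card.choose k := by
  induction k, hjk using Nat.le_induction with
  | base => exact le_rfl
  | succ k hjk ih =>
    have h1 := mul_card_slice_succ_le hN hF k
    have h2 := Nat.choose_succ_right_eq N.card k
    have h3 := ih (by omega)
    have h4 : 0 < N.card.choose k := Nat.choose_pos (by omega)
    have h5 : (F # (k + 1)).card * N.card.choose k ≤ (F # k).card * N.card.choose (k + 1) := by
      refine Nat.le_of_mul_le_mul_left ?_ (Nat.succ_pos k)
      calc (k + 1) * ((F # (k + 1)).card * N.card.choose k)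
          = (k + 1) * (F # (k + 1)).card * N.card.choose k := by ring
        _ ≤ (N.card - k) * (F # k).card * N.card.choose k := Nat.mul_le_mul_right _ h1
        _ = (F # k).card * (N.card.choose k * (N.card - k)) := by ring
        _ = (k + 1) * ((F # k).card * N.card.choose (k + 1)) := by rw [← h2]; ring
    refine Nat.le_of_mul_le_mul_left ?_ h4
    calc N.card.choose k * ((F # (k + 1)).card * N.card.choose j)
        = (F # (k + 1)).card * N.card.choose k * N.card.choose j := by ring
      _ ≤ (F # k).card * N.card.choose (k + 1) * N.card.choose j := Nat.mul_le_mul_right _ h5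
      _ = (F # k).card * N.card.choose j * N.card.choose (k + 1) := by ring
      _ ≤ (F # j).card * N.card.choose k * N.card.choose (k + 1) := Nat.mul_le_mul_right _ h3
      _ = _ := by ring

theorem sum_card_eq_sum_slice {N : Finset V} {F : Finset (Finset V)} (hN : ∀ A ∈ F, A ⊆ N)
    (g : ℕ → ℝ) :
    ∑ A ∈ F, g A.card = ∑ j ∈ range (N.card + 1), ((F # j).card : ℝ) * g j := by
  rw [← sum_fiberwise_of_maps_to (g := card) (t := range (N.card + 1))
    fun A hA => mem_range.2 (Nat.lt_succ_of_le (card_le_card (hN A hA)))]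
  refine sum_congr rfl fun j _ => ?_
  rw [sum_congr rfl fun A hA => by rw [(mem_filter.1 hA).2], sum_const, nsmul_eq_mul]
  rfl

/-- Difference between the mean size of a nonempty member of the full power set and of a nonempty
member of `F`, up to normalisation, where the ground set has `d` elements. -/
noncomputable def sizeGap (d : ℕ) (lam : ℝ) (F : Finset (Finset V)) : ℝ :=
  d * lam * (1 + lam) ^ (d - 1) * (∑ A ∈ F, lam ^ A.card - 1)
    - ((1 + lam) ^ d - 1) * ∑ A ∈ F, (A.card : ℝ) * lam ^ A.card

theorem sum_range_choose_succ_mul_pow (d : ℕ) (lam : ℝ) :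
    ∑ k ∈ range d, (d.choose (k + 1) : ℝ) * lam ^ (k + 1) = (1 + lam) ^ d - 1 := by
  rw [add_comm 1 lam, add_pow, sum_range_succ']
  simp [mul_comm]

theorem sum_range_mul_choose_succ_mul_pow (d : ℕ) (lam : ℝ) :
    ∑ k ∈ range d, ((k : ℝ) + 1) * ((d.choose (k + 1) : ℝ) * lam ^ (k + 1)) =
      d * lam * (1 + lam) ^ (d - 1) := by
  rcases d with _ | d
  · simp
  · rw [Nat.add_sub_cancel, add_comm 1 lam, add_pow, mul_sum]
    refine sum_congr rfl fun k _ => ?_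
    have : ((d : ℝ) + 1) * d.choose k = (d + 1).choose (k + 1) * (k + 1) := by
      exact_mod_cast Nat.add_one_mul_choose_eq d k
    push_cast
    rw [one_pow, pow_succ]
    linear_combination (-(lam ^ k * lam)) * this

/-- Chebyshev's sum argument: expand the products over nonempty levels and symmetrise in the two
level indices. Each summand pairs the sign of `k - j` with a comparison of normalised level sizes,
so down-closure makes it nonnegative. Indices are shifted by one because the empty set has been
removed. -/
theorem sizeGap_eq_double_sum {N : Finset V} {F : Finset (Finset V)} (h0 : ∅ ∈ F)
    (hN : ∀ A ∈ F, A ⊆ N) (lam : ℝ) :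
    2 * sizeGap N.card lam F = ∑ j ∈ range N.card, ∑ k ∈ range N.card,
      ((k : ℝ) - j) * ((F # (j + 1)).card * N.card.choose (k + 1)
        - (F # (k + 1)).card * N.card.choose (j + 1)) * lam ^ (j + k + 2) := by
  have hP : ∑ A ∈ F, lam ^ A.card - 1 =
      ∑ j ∈ range N.card, ((F # (j + 1)).card : ℝ) * lam ^ (j + 1) := by
    rw [sum_card_eq_sum_slice hN fun j => lam ^ j, sum_range_succ']
    have : F # 0 = {∅} := by
      ext A
      simp only [mem_slice, card_eq_zero, mem_singleton]
      exact ⟨fun h => h.2, fun h => ⟨h ▸ h0, h⟩⟩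
    simp [this]
  have hQ : ∑ A ∈ F, (A.card : ℝ) * lam ^ A.card =
      ∑ j ∈ range N.card, ((F # (j + 1)).card : ℝ) * (((j : ℝ) + 1) * lam ^ (j + 1)) := by
    rw [sum_card_eq_sum_slice hN fun j => (j : ℝ) * lam ^ j, sum_range_succ']
    simp
  have hX : sizeGap N.card lam F = ∑ j ∈ range N.card, ∑ k ∈ range N.card,
      ((k : ℝ) - j) * ((F # (j + 1)).card * N.card.choose (k + 1)) * lam ^ (j + k + 2) := by
    rw [sizeGap, ← sum_range_choose_succ_mul_pow, ← sum_range_mul_choose_succ_mul_pow, hP, hQ,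
      mul_comm, sum_mul_sum, mul_comm (∑ k ∈ range N.card, _), sum_mul_sum, ← sum_sub_distrib]
    refine sum_congr rfl fun j _ => ?_
    rw [← sum_sub_distrib]
    refine sum_congr rfl fun k _ => ?_
    rw [show j + k + 2 = (j + 1) + (k + 1) by ring, pow_add lam (j + 1)]
    ring
  rw [two_mul]
  nth_rewrite 2 [hX]
  rw [sum_comm, hX, ← sum_add_distrib]
  refine sum_congr rfl fun j _ => ?_
  rw [← sum_add_distrib]
  refine sum_congr rfl fun k _ => ?_
  rw [add_comm k j]
  ring

theorem sizeGap_summand_nonneg {N : Finset V} {F : Finset (Finset V)}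
    (hN : ∀ A ∈ F, A ⊆ N) (hF : ∀ A ∈ F, ∀ B ⊆ A, B ∈ F) {lam : ℝ} (hlam : 0 ≤ lam)
    {j k : ℕ} (hj : j < N.card) (hk : k < N.card) :
    0 ≤ ((k : ℝ) - j) * ((F # (j + 1)).card * N.card.choose (k + 1)
        - (F # (k + 1)).card * N.card.choose (j + 1)) * lam ^ (j + k + 2) := by
  refine mul_nonneg ?_ (by positivity)
  rcases le_total j k with h | h
  · refine mul_nonneg (sub_nonneg.2 (by exact_mod_cast h)) (sub_nonneg.2 ?_)
    exact_mod_cast card_slice_mul_choose_le hN hF (Nat.succ_le_succ h) hk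
  · refine mul_nonneg_of_nonpos_of_nonpos (sub_nonpos.2 (by exact_mod_cast h)) (sub_nonpos.2 ?_)
    exact_mod_cast card_slice_mul_choose_le hN hF (Nat.succ_le_succ h) hj

theorem sizeGap_nonneg {N : Finset V} {F : Finset (Finset V)} (h0 : ∅ ∈ F)
    (hN : ∀ A ∈ F, A ⊆ N) (hF : ∀ A ∈ F, ∀ B ⊆ A, B ∈ F) {lam : ℝ} (hlam : 0 ≤ lam) :
    0 ≤ sizeGap N.card lam F := by
  have h := sizeGap_eq_double_sum h0 hN lam
  have : 0 ≤ 2 * sizeGap N.card lam F := by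
    rw [h]
    exact sum_nonneg fun j hj => sum_nonneg fun k hk =>
      sizeGap_summand_nonneg hN hF hlam (mem_range.1 hj) (mem_range.1 hk)
  linarith

/-- The size gap of a down-closed family that is neither trivial nor the full power set. -/
theorem pow_le_sizeGap {N : Finset V} {F : Finset (Finset V)}
    (hN : ∀ A ∈ F, A ⊆ N) (hF : ∀ A ∈ F, ∀ B ⊆ A, B ∈ F) {lam : ℝ} (hlam : 0 ≤ lam)
    {x : V} (hx : {x} ∈ F) (hfull : N ∉ F) :
    lam ^ (N.card + 1) ≤ sizeGap N.card lam F := by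
  classical
  have h0 : ∅ ∈ F := hF _ hx _ (empty_subset _)
  have hcard : 2 ≤ N.card := by
    have hxN := hN _ hx
    have h1 : ({x} : Finset V).card < N.card := card_lt_card
      (hxN.ssubset_of_ne fun h => hfull (h ▸ hx))
    rw [card_singleton] at h1
    exact h1
  obtain ⟨m, hm⟩ : ∃ m, N.card = m + 2 := ⟨N.card - 2, by omega⟩
  have htop : (F # N.card) = ∅ := by
    refine eq_empty_of_forall_notMem fun A hA => hfull ?_
    rw [mem_slice] at hA
    rw [← eq_of_subset_of_card_le (hN A hA.1) hA.2.ge]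
    exact hA.1
  have hone : 1 ≤ (F # 1).card := card_pos.2 ⟨{x}, mem_slice.2 ⟨hx, by simp⟩⟩
  have h := sizeGap_eq_double_sum h0 hN lam
  set T : ℕ → ℕ → ℝ := fun j k => ((k : ℝ) - j) * ((F # (j + 1)).card * N.card.choose (k + 1)
        - (F # (k + 1)).card * N.card.choose (j + 1)) * lam ^ (j + k + 2) with hT
  have hnn : ∀ j ∈ range N.card, ∀ k ∈ range N.card, 0 ≤ T j k := fun j hj k hk =>
    sizeGap_summand_nonneg hN hF hlam (mem_range.1 hj) (mem_range.1 hk)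
  -- Only levels `1` and `N.card` are retained. The top level is empty and level `1` is not, so the
  -- two orderings of this pair each contribute at least `lam ^ (N.card + 1)`, matching the factor
  -- `2`.
  have hm0 : 0 ∈ range N.card := mem_range.2 (by omega)
  have hm1 : m + 1 ∈ range N.card := mem_range.2 (by omega)
  have hA : T 0 (m + 1) ≤ ∑ k ∈ range N.card, T 0 k := single_le_sum (hnn 0 hm0) hm1
  have hB : T (m + 1) 0 ≤ ∑ k ∈ range N.card, T (m + 1) k := single_le_sum (hnn _ hm1) hm0
  have hC : ∑ j ∈ ({0, m + 1} : Finset ℕ), ∑ k ∈ range N.card, T j k ≤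
      ∑ j ∈ range N.card, ∑ k ∈ range N.card, T j k := by
    refine sum_le_sum_of_subset_of_nonneg ?_ fun j hj _ => sum_nonneg (hnn j hj)
    intro j hj
    rcases mem_insert.1 hj with rfl | hj
    · exact hm0
    · rw [mem_singleton.1 hj]; exact hm1
  rw [sum_pair (by omega)] at hC
  have hval : ∀ p : ℝ, 0 ≤ p → p ≤ ((m : ℝ) + 1) * (F # 1).card * p := by
    intro p hp
    have h1 : (1 : ℝ) ≤ (F # 1).card := by exact_mod_cast hone
    have h2 : (1 : ℝ) ≤ ((m : ℝ) + 1) * (F # 1).card := by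
      nlinarith [(Nat.cast_nonneg m : (0 : ℝ) ≤ m)]
    nlinarith
  have htop' : (F # (m + 1 + 1)) = ∅ := by rw [← hm] at *; exact htop
  have hc1 : N.card.choose (m + 1 + 1) = 1 := by rw [hm]; simp
  have e1 : T 0 (m + 1) = ((m : ℝ) + 1) * (F # 1).card * lam ^ (N.card + 1) := by
    simp only [hT, zero_add, htop', hc1]
    rw [hm]
    push_cast
    simp only [card_empty]
    ring
  have e2 : T (m + 1) 0 = ((m : ℝ) + 1) * (F # 1).card * lam ^ (N.card + 1) := by
    simp only [hT, zero_add, htop', hc1]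
    rw [hm]
    push_cast
    simp only [card_empty]
    ring
  have := hval (lam ^ (N.card + 1)) (by positivity)
  linarith

theorem sum_powerset_pow_card (N : Finset V) (lam : ℝ) :
    ∑ A ∈ N.powerset, lam ^ A.card = (1 + lam) ^ N.card := by
  have := sum_pow_mul_eq_add_pow lam 1 N
  simp only [one_pow, mul_one] at this
  rw [this, add_comm]

/-- Level sizes equal the binomial coefficients, so every bracket in the double sum cancels. This
and `sizeGap_singleton_empty` cover the two families arising at a good vertex. -/
theorem sizeGap_powerset (N : Finset V) (lam : ℝ) : sizeGap N.card lam N.powerset = 0 := by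
  have h := sizeGap_eq_double_sum (N := N) (F := N.powerset) (by simp)
    (fun A hA => mem_powerset.1 hA) lam
  have hs : ∀ j, (N.powerset # j).card = N.card.choose j := fun j => by
    rw [← card_powersetCard, powersetCard_eq_filter]; rfl
  simp only [hs, mul_comm, sub_self, mul_zero, sum_const_zero] at h
  linarith

theorem sizeGap_singleton_empty (d : ℕ) (lam : ℝ) : sizeGap d lam ({∅} : Finset (Finset V)) = 0 := by
  simp [sizeGap]

end DownClosed

end OccStability

/-! ### The hard-core model -/

namespace OccStability

open scoped Classical

section HardCore

open Finset

theorem sum_le_sum_of_injOn {ι κ : Type*} {s : Finset ι} {t : Finset κ} {f : ι → ℝ} {g : κ → ℝ}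
    (i : ι → κ) (hi : ∀ a ∈ s, i a ∈ t) (hinj : Set.InjOn i s) (hfg : ∀ a ∈ s, f a ≤ g (i a))
    (hg : ∀ b ∈ t, 0 ≤ g b) : ∑ a ∈ s, f a ≤ ∑ b ∈ t, g b := by
  calc ∑ a ∈ s, f a ≤ ∑ a ∈ s, g (i a) := sum_le_sum hfg
    _ = ∑ b ∈ s.image i, g b := (sum_image hinj).symm
    _ ≤ ∑ b ∈ t, g b := sum_le_sum_of_subset_of_nonneg (image_subset_iff.2 hi) fun b hb _ => hg b hb

variable {V : Type*} [Fintype V]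

/-- The neighbourhood of `v` as a finset. -/
noncomputable def nb (G : SimpleGraph V) (v : V) : Finset V := univ.filter (G.Adj v)

@[simp] theorem mem_nb {G : SimpleGraph V} {v u : V} : u ∈ nb G v ↔ G.Adj v u := by simp [nb]

theorem card_nb {G : SimpleGraph V} [G.LocallyFinite] {d : ℕ} (h : G.IsRegularOfDegree d) (v : V) :
    (nb G v).card = d := by
  rw [← h v, ← SimpleGraph.card_neighborFinset_eq_degree]
  congr 1
  ext u
  simp

theorem sum_sum_nb {G : SimpleGraph V} {d : ℕ} (h : ∀ v, (nb G v).card = d) (f : V → ℝ) :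
    ∑ v, ∑ u ∈ nb G v, f u = d * ∑ u, f u := by
  have : ∀ v, ∑ u ∈ nb G v, f u = ∑ u, if G.Adj v u then f u else 0 := fun v => by
    rw [nb, sum_filter]
  simp only [this]
  rw [sum_comm, mul_sum]
  refine sum_congr rfl fun u _ => ?_
  rw [← h u, nb, ← sum_filter, sum_const, nsmul_eq_mul]
  simp only [G.adj_comm]

/-- `v` has an independent neighbourhood whose vertices all have the same neighbours. In a regular
graph this means that the component of `v` is complete bipartite. -/
def IsGood (G : SimpleGraph V) (v : V) : Prop :=
  (∀ u u', G.Adj v u → G.Adj v u' → ¬ G.Adj u u') ∧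
    ∀ u u' w, G.Adj v u → G.Adj v u' → G.Adj u w → G.Adj u' w

theorem isGood_Kdd (d : ℕ) (v : Fin d ⊕ Fin d) : IsGood (Kdd d) v := by
  constructor
  · rintro (u | u) (u' | u') <;> rcases v with v | v <;> simp
  · rintro (u | u) (u' | u') (w | w) <;> rcases v with v | v <;> simp

theorem card_nb_Kdd (d : ℕ) (v : Fin d ⊕ Fin d) : (nb (Kdd d) v).card = d := by
  rcases v with v | v
  · have : nb (Kdd d) (Sum.inl v) = univ.map ⟨Sum.inr, Sum.inr_injective⟩ := by
      ext (u | u) <;> simp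
    simp [this]
  · have : nb (Kdd d) (Sum.inr v) = univ.map ⟨Sum.inl, Sum.inl_injective⟩ := by
      ext (u | u) <;> simp
    simp [this]

theorem mem_indepSets {G : SimpleGraph V} {I : Finset V} :
    I ∈ indepSets G ↔ ∀ x ∈ I, ∀ y ∈ I, ¬ G.Adj x y := by
  simp only [indepSets, mem_filter, mem_univ, true_and, SimpleGraph.isIndepSet_iff]
  exact ⟨fun h x hx y hy hxy => h hx hy hxy.ne hxy, fun h x hx y hy _ => h x hx y hy⟩

theorem indepSets_mono {G : SimpleGraph V} {I J : Finset V} (h : I ∈ indepSets G) (hJ : J ⊆ I) :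
    J ∈ indepSets G :=
  mem_indepSets.2 fun x hx y hy => mem_indepSets.1 h x (hJ hx) y (hJ hy)

theorem zInd_pos (G : SimpleGraph V) {lam : ℝ} (hlam : 0 ≤ lam) : 0 < zInd G lam :=
  sum_pos' (fun I _ => by positivity) ⟨∅, mem_indepSets.2 (by simp), by simp⟩

/-- Independent sets avoiding the closed neighbourhood of `v`. -/
noncomputable def outerSets (G : SimpleGraph V) (v : V) : Finset (Finset V) :=
  (indepSets G).filter fun J => ∀ x ∈ J, x ≠ v ∧ ¬ G.Adj v x

/-- The sets of neighbours of `v` compatible with the boundary condition `J`. -/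
noncomputable def innerSets (G : SimpleGraph V) (v : V) (J : Finset V) : Finset (Finset V) :=
  (nb G v).powerset.filter fun A => A ∪ J ∈ indepSets G

theorem mem_outerSets {G : SimpleGraph V} {v : V} {J : Finset V} :
    J ∈ outerSets G v ↔ J ∈ indepSets G ∧ ∀ x ∈ J, x ≠ v ∧ ¬ G.Adj v x := by
  simp [outerSets]

theorem mem_innerSets {G : SimpleGraph V} {v : V} {J A : Finset V} :
    A ∈ innerSets G v J ↔ (∀ x ∈ A, G.Adj v x) ∧ A ∪ J ∈ indepSets G := by
  simp [innerSets, subset_iff]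

theorem disjoint_of_mem_outerSets {G : SimpleGraph V} {v : V} {J A : Finset V}
    (hJ : J ∈ outerSets G v) (hA : A ∈ innerSets G v J) : Disjoint A J :=
  disjoint_left.2 fun x hx hxJ =>
    ((mem_outerSets.1 hJ).2 x hxJ).2 ((mem_innerSets.1 hA).1 x hx)

/-- Conditioning on the part of an independent set outside the closed neighbourhood of `v`. -/
theorem sum_indepSets_eq (G : SimpleGraph V) (v : V) (φ : Finset V → ℝ) :
    ∑ I ∈ indepSets G, φ I =
      ∑ J ∈ outerSets G v, (φ (insert v J) + ∑ A ∈ innerSets G v J, φ (A ∪ J)) := by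
  rw [sum_add_distrib, ← sum_filter_add_sum_filter_not (indepSets G) (fun I => v ∈ I)]
  congr 1
  · refine sum_nbij' (fun I => I.erase v) (fun J => insert v J) ?_ ?_ ?_ ?_ ?_
    · intro I hI
      simp only [mem_filter] at hI
      refine mem_outerSets.2 ⟨indepSets_mono hI.1 (erase_subset _ _), fun x hx => ?_⟩
      exact ⟨(mem_erase.1 hx).1, mem_indepSets.1 hI.1 v hI.2 x (mem_erase.1 hx).2⟩
    · intro J hJ
      obtain ⟨h1, h2⟩ := mem_outerSets.1 hJ
      refine mem_filter.2 ⟨mem_indepSets.2 fun x hx y hy hxy => ?_, mem_insert_self _ _⟩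
      rcases mem_insert.1 hx with rfl | hx' <;> rcases mem_insert.1 hy with rfl | hy'
      · exact hxy.ne rfl
      · exact (h2 y hy').2 hxy
      · exact (h2 x hx').2 hxy.symm
      · exact mem_indepSets.1 h1 x hx' y hy' hxy
    · intro I hI
      exact insert_erase (mem_filter.1 hI).2
    · intro J hJ
      exact erase_insert fun h => ((mem_outerSets.1 hJ).2 v h).1 rfl
    · intro I hI
      rw [insert_erase (mem_filter.1 hI).2]
  · rw [sum_sigma']
    refine sum_nbij' (fun I => ⟨I \ nb G v, I ∩ nb G v⟩) (fun p => p.2 ∪ p.1) ?_ ?_ ?_ ?_ ?_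
    · intro I hI
      simp only [mem_filter] at hI
      refine mem_sigma.2 ⟨mem_outerSets.2 ⟨indepSets_mono hI.1 sdiff_subset, fun x hx => ?_⟩,
        mem_innerSets.2 ⟨fun x hx => mem_nb.1 (mem_inter.1 hx).2, ?_⟩⟩
      · simp only [mem_sdiff, mem_nb] at hx
        exact ⟨fun h => hI.2 (h ▸ hx.1), hx.2⟩
      · exact indepSets_mono hI.1 (union_subset inter_subset_left sdiff_subset)
    · rintro ⟨J, A⟩ hp
      obtain ⟨hJ, hA⟩ := mem_sigma.1 hp
      refine mem_filter.2 ⟨(mem_innerSets.1 hA).2, fun h => ?_⟩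
      rcases mem_union.1 h with h | h
      · exact ((mem_innerSets.1 hA).1 v h).ne rfl
      · exact ((mem_outerSets.1 hJ).2 v h).1 rfl
    · intro I _
      rw [union_comm, sdiff_union_inter]
    · rintro ⟨J, A⟩ hp
      obtain ⟨hJ, hA⟩ := mem_sigma.1 hp
      have h1 : (A ∪ J) \ nb G v = J := by
        ext x
        simp only [mem_sdiff, mem_union, mem_nb]
        have := (mem_innerSets.1 hA).1 x
        have := (mem_outerSets.1 hJ).2 x
        tauto
      have h2 : (A ∪ J) ∩ nb G v = A := by
        ext x
        simp only [mem_inter, mem_union, mem_nb]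
        have := (mem_innerSets.1 hA).1 x
        have := (mem_outerSets.1 hJ).2 x
        tauto
      simp only [h1, h2]
    · intro I _
      simp only
      rw [union_comm, sdiff_union_inter]

/-- Total weight of the independent sets containing `v`. -/
noncomputable def occWeight (G : SimpleGraph V) (lam : ℝ) (v : V) : ℝ :=
  ∑ I ∈ indepSets G, if v ∈ I then lam ^ I.card else 0

theorem sum_occWeight (G : SimpleGraph V) (lam : ℝ) (U : Finset V) :
    ∑ u ∈ U, occWeight G lam u = ∑ I ∈ indepSets G, ((I ∩ U).card : ℝ) * lam ^ I.card := by
  unfold occWeight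
  rw [sum_comm]
  refine sum_congr rfl fun I _ => ?_
  rw [← sum_filter, sum_const, nsmul_eq_mul, inter_comm, filter_mem_eq_inter]

theorem card_mul_alphaInd [Nonempty V] (G : SimpleGraph V) {lam : ℝ} (hlam : 0 ≤ lam) :
    ∑ u, occWeight G lam u = Fintype.card V * alphaInd G lam * zInd G lam := by
  have hZ := (zInd_pos G hlam).ne'
  have hn : (Fintype.card V : ℝ) ≠ 0 := by exact_mod_cast Fintype.card_ne_zero
  rw [sum_occWeight, alphaInd]
  simp only [inter_univ, ← mul_div_assoc, ← sum_div]
  field_simp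

theorem not_mem_of_mem_innerSets {G : SimpleGraph V} {v : V} {J A : Finset V}
    (hJ : J ∈ outerSets G v) (hA : A ∈ innerSets G v J) : v ∉ A ∪ J := fun h => by
  rcases mem_union.1 h with h | h
  · exact ((mem_innerSets.1 hA).1 v h).ne rfl
  · exact ((mem_outerSets.1 hJ).2 v h).1 rfl

/-- The accumulated size gap seen from `v`. -/
noncomputable def indGap (G : SimpleGraph V) (lam : ℝ) (v : V) : ℝ :=
  ∑ J ∈ outerSets G v, lam ^ J.card * sizeGap (nb G v).card lam (innerSets G v J)

/-- Given `J`, either `v` is occupied, with weight `lam` times that of `J`, or a compatible set of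
neighbours is chosen. Hence the sums over `J` of the quantities in `sizeGap` reduce to the partition
function and the occupation weights of `v` and its neighbours. -/
theorem indGap_eq (G : SimpleGraph V) (lam : ℝ) (v : V) (hd : (nb G v).card ≠ 0) :
    indGap G lam v = (nb G v).card * lam * (1 + lam) ^ ((nb G v).card - 1) * zInd G lam
      - (nb G v).card * (1 + lam) ^ (nb G v).card * occWeight G lam v
      - ((1 + lam) ^ (nb G v).card - 1) * ∑ u ∈ nb G v, occWeight G lam u := by
  have hins : ∀ J ∈ outerSets G v, (insert v J).card = J.card + 1 := fun J hJ =>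
    card_insert_of_notMem fun h => ((mem_outerSets.1 hJ).2 v h).1 rfl
  have hun : ∀ J ∈ outerSets G v, ∀ A ∈ innerSets G v J, (A ∪ J).card = A.card + J.card :=
    fun J hJ A hA => card_union_of_disjoint (disjoint_of_mem_outerSets hJ hA)
  have hZ : zInd G lam = lam * ∑ J ∈ outerSets G v, lam ^ J.card +
      ∑ J ∈ outerSets G v, lam ^ J.card * ∑ A ∈ innerSets G v J, lam ^ A.card := by
    rw [zInd, sum_indepSets_eq G v, mul_sum, ← sum_add_distrib]
    refine sum_congr rfl fun J hJ => ?_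
    rw [hins J hJ, mul_sum, pow_succ']
    congr 1
    refine sum_congr rfl fun A hA => ?_
    rw [hun J hJ A hA, pow_add, mul_comm]
  have hO : occWeight G lam v = lam * ∑ J ∈ outerSets G v, lam ^ J.card := by
    rw [occWeight, sum_indepSets_eq G v, mul_sum]
    refine sum_congr rfl fun J hJ => ?_
    rw [if_pos (mem_insert_self _ _), hins J hJ, pow_succ',
      sum_eq_zero fun A hA => if_neg (not_mem_of_mem_innerSets hJ hA), add_zero]
  have hN : ∑ u ∈ nb G v, occWeight G lam u =
      ∑ J ∈ outerSets G v, lam ^ J.card * ∑ A ∈ innerSets G v J, (A.card : ℝ) * lam ^ A.card := by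
    rw [sum_occWeight, sum_indepSets_eq G v]
    refine sum_congr rfl fun J hJ => ?_
    have h1 : insert v J ∩ nb G v = ∅ := by
      ext x
      simp only [mem_inter, mem_insert, mem_nb, notMem_empty, iff_false]
      rintro ⟨rfl | h, h'⟩
      · exact h'.ne rfl
      · exact ((mem_outerSets.1 hJ).2 x h).2 h'
    rw [h1, card_empty, Nat.cast_zero, zero_mul, zero_add, mul_sum]
    refine sum_congr rfl fun A hA => ?_
    have h2 : (A ∪ J) ∩ nb G v = A := by
      ext x
      simp only [mem_inter, mem_union, mem_nb]
      have := (mem_innerSets.1 hA).1 x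
      have := (mem_outerSets.1 hJ).2 x
      tauto
    rw [h2, hun J hJ A hA, pow_add]
    ring
  have hR : indGap G lam v = (nb G v).card * lam * (1 + lam) ^ ((nb G v).card - 1) *
      (∑ J ∈ outerSets G v, lam ^ J.card * ∑ A ∈ innerSets G v J, lam ^ A.card
        - ∑ J ∈ outerSets G v, lam ^ J.card)
      - ((1 + lam) ^ (nb G v).card - 1) * ∑ J ∈ outerSets G v,
        lam ^ J.card * ∑ A ∈ innerSets G v J, (A.card : ℝ) * lam ^ A.card := by
    rw [indGap, ← sum_sub_distrib, mul_sum, mul_sum, ← sum_sub_distrib]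
    refine sum_congr rfl fun J _ => ?_
    rw [sizeGap]
    ring
  rw [hR, hN, hZ, hO]
  obtain ⟨m, hm⟩ := Nat.exists_eq_succ_of_ne_zero hd
  rw [hm, Nat.succ_eq_add_one, Nat.add_sub_cancel, pow_succ]
  ring

/-- By regularity each occupation weight is counted `d` times among the neighbour sums, so only the
occupancy fraction survives. Nonnegative gaps thus bound it from above, with equality when all gaps
vanish. -/
theorem sum_indGap [Nonempty V] {G : SimpleGraph V} {d : ℕ} (hd : 1 ≤ d)
    (hG : ∀ v, (nb G v).card = d) {lam : ℝ} (hlam : 0 ≤ lam) :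
    ∑ v, indGap G lam v = d * Fintype.card V * zInd G lam *
      (lam * (1 + lam) ^ (d - 1) - (2 * (1 + lam) ^ d - 1) * alphaInd G lam) := by
  have h1 := card_mul_alphaInd G hlam
  have h2 := sum_sum_nb hG (occWeight G lam)
  have h3 : ∀ v, indGap G lam v = d * lam * (1 + lam) ^ (d - 1) * zInd G lam
      - d * (1 + lam) ^ d * occWeight G lam v
      - ((1 + lam) ^ d - 1) * ∑ u ∈ nb G v, occWeight G lam u := fun v => by
    have := indGap_eq G lam v (by rw [hG]; omega)
    rwa [hG] at this
  simp only [h3, sum_sub_distrib, ← mul_sum, h2, h1, sum_const, card_univ, nsmul_eq_mul]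
  ring

/-- The neighbours of a good vertex have the same neighbours, so a vertex of `J` blocks all of them
or none, and they do not block one another. -/
theorem innerSets_eq_of_isGood {G : SimpleGraph V} {v : V} (hv : IsGood G v) {J : Finset V}
    (hJ : J ∈ outerSets G v) :
    innerSets G v J = {∅} ∨ innerSets G v J = (nb G v).powerset := by
  obtain ⟨h1, h2⟩ := mem_outerSets.1 hJ
  by_cases h : ∃ w ∈ J, ∃ u, G.Adj v u ∧ G.Adj u w
  · left
    obtain ⟨w, hw, u, hu, huw⟩ := h
    ext A
    rw [mem_singleton, mem_innerSets]
    constructor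
    · rintro ⟨hA, hAJ⟩
      refine eq_empty_of_forall_notMem fun x hx => ?_
      exact mem_indepSets.1 hAJ x (mem_union_left _ hx) w (mem_union_right _ hw)
        (hv.2 u x w hu (hA x hx) huw)
    · rintro rfl
      simpa using h1
  · right
    push Not at h
    ext A
    rw [mem_powerset, mem_innerSets]
    constructor
    · exact fun hA x hx => mem_nb.2 (hA.1 x hx)
    · intro hA
      have hA' : ∀ x ∈ A, G.Adj v x := fun x hx => mem_nb.1 (hA hx)
      refine ⟨hA', mem_indepSets.2 fun x hx y hy hxy => ?_⟩
      rcases mem_union.1 hx with hx | hx <;> rcases mem_union.1 hy with hy | hy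
      · exact hv.1 x y (hA' x hx) (hA' y hy) hxy
      · exact h y hy x (hA' x hx) hxy
      · exact h x hx y (hA' y hy) hxy.symm
      · exact mem_indepSets.1 h1 x hx y hy hxy

theorem indGap_eq_zero_of_isGood {G : SimpleGraph V} {v : V} (hv : IsGood G v) (lam : ℝ) :
    indGap G lam v = 0 := by
  refine sum_eq_zero fun J hJ => ?_
  rcases innerSets_eq_of_isGood hv hJ with h | h
  · rw [h, sizeGap_singleton_empty, mul_zero]
  · rw [h, sizeGap_powerset, mul_zero]

theorem alphaInd_Kdd {d : ℕ} (hd : 1 ≤ d) {lam : ℝ} (hlam : 0 ≤ lam) :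
    (2 * (1 + lam) ^ d - 1) * alphaInd (Kdd d) lam = lam * (1 + lam) ^ (d - 1) := by
  have : Nonempty (Fin d ⊕ Fin d) := ⟨Sum.inl ⟨0, hd⟩⟩
  have h := sum_indGap hd (card_nb_Kdd d) hlam
  rw [sum_eq_zero fun v _ => indGap_eq_zero_of_isGood (isGood_Kdd d v) lam] at h
  have hZ := (zInd_pos (Kdd d) hlam).ne'
  have hn : (Fintype.card (Fin d ⊕ Fin d) : ℝ) ≠ 0 := by exact_mod_cast Fintype.card_ne_zero
  have hd' : (d : ℝ) ≠ 0 := by positivity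
  have := (mul_eq_zero.1 h.symm).resolve_left (by positivity)
  linarith

theorem innerSets_subset {G : SimpleGraph V} {v : V} {J : Finset V} :
    ∀ A ∈ innerSets G v J, A ⊆ nb G v := fun _ hA x hx => mem_nb.2 ((mem_innerSets.1 hA).1 x hx)

theorem innerSets_down {G : SimpleGraph V} {v : V} {J : Finset V} :
    ∀ A ∈ innerSets G v J, ∀ B ⊆ A, B ∈ innerSets G v J := fun _ hA _ hB =>
  mem_innerSets.2 ⟨fun x hx => (mem_innerSets.1 hA).1 x (hB hx),
    indepSets_mono (mem_innerSets.1 hA).2 (union_subset_union hB Subset.rfl)⟩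

theorem empty_mem_innerSets {G : SimpleGraph V} {v : V} {J : Finset V} (hJ : J ∈ outerSets G v) :
    ∅ ∈ innerSets G v J := mem_innerSets.2 ⟨by simp, by simpa using (mem_outerSets.1 hJ).1⟩

theorem indGap_nonneg (G : SimpleGraph V) {lam : ℝ} (hlam : 0 ≤ lam) (v : V) :
    0 ≤ indGap G lam v :=
  sum_nonneg fun _ hJ => mul_nonneg (by positivity)
    (sizeGap_nonneg (empty_mem_innerSets hJ) innerSets_subset innerSets_down hlam)

/-- The probability that a random independent set meets `S` exactly in `T` is bounded below. -/
theorem zInd_le_sum_inter_eq {G : SimpleGraph V} {lam : ℝ} (hlam : 0 ≤ lam) {S T : Finset V}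
    (hTS : T ⊆ S) (hT : T ∈ indepSets G) (hcl : ∀ x ∈ T, ∀ y, G.Adj x y → y ∈ S) :
    lam ^ T.card * zInd G lam ≤
      (1 + lam) ^ S.card * ∑ I ∈ (indepSets G).filter (fun I => I ∩ S = T), lam ^ I.card := by
  -- Splitting off the part inside `S`, and allowing any subset of `S` there, loses at most the
  -- factor `(1 + lam) ^ S.card`.
  have h1 : zInd G lam ≤ ∑ p ∈ ((indepSets G).filter fun I => Disjoint I S) ×ˢ S.powerset,
      lam ^ p.1.card * lam ^ p.2.card := by
    refine sum_le_sum_of_injOn (fun I => (I \ S, I ∩ S)) ?_ ?_ ?_ fun _ _ => by positivity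
    · intro I hI
      refine mem_product.2 ⟨mem_filter.2 ⟨indepSets_mono hI sdiff_subset, sdiff_disjoint⟩, ?_⟩
      exact mem_powerset.2 inter_subset_right
    · intro I _ I' _ h
      rw [Prod.mk.injEq] at h
      rw [← sdiff_union_inter I S, h.1, h.2, sdiff_union_inter]
    · intro I _
      rw [← pow_add, card_sdiff_add_card_inter]
  rw [sum_product] at h1
  simp only at h1
  rw [← sum_mul_sum, sum_powerset_pow_card] at h1
  -- A set disjoint from `S` may be enlarged by `T`, since all neighbours of `T` lie in `S`.
  have h2 : lam ^ T.card * ∑ K ∈ (indepSets G).filter (fun I => Disjoint I S), lam ^ K.card ≤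
      ∑ I ∈ (indepSets G).filter (fun I => I ∩ S = T), lam ^ I.card := by
    rw [mul_sum]
    refine sum_le_sum_of_injOn (fun K => T ∪ K) ?_ ?_ ?_ fun _ _ => by positivity
    · intro K hK
      obtain ⟨hK, hKS⟩ := mem_filter.1 hK
      refine mem_filter.2 ⟨mem_indepSets.2 fun x hx y hy hxy => ?_, ?_⟩
      · rcases mem_union.1 hx with hx | hx <;> rcases mem_union.1 hy with hy | hy
        · exact mem_indepSets.1 hT x hx y hy hxy
        · exact disjoint_left.1 hKS hy (hcl x hx y hxy)
        · exact disjoint_left.1 hKS hx (hcl y hy x hxy.symm)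
        · exact mem_indepSets.1 hK x hx y hy hxy
      · rw [union_inter_distrib_right, disjoint_iff_inter_eq_empty.1 hKS, union_empty]
        exact inter_eq_left.2 hTS
    · intro K hK K' hK' h
      have hd : ∀ L ∈ (indepSets G).filter (fun I => Disjoint I S), (T ∪ L) \ S = L := fun L hL => by
        rw [union_sdiff_distrib, sdiff_eq_empty_iff_subset.2 hTS, empty_union]
        exact sdiff_eq_self_of_disjoint (mem_filter.1 hL).2
      rw [← hd K hK, ← hd K' hK']
      exact congrArg (· \ S) h
    · intro K hK
      rw [card_union_of_disjoint, pow_add]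
      exact ((mem_filter.1 hK).2.symm).mono_left hTS
  calc lam ^ T.card * zInd G lam ≤ lam ^ T.card *
        ((∑ K ∈ (indepSets G).filter (fun I => Disjoint I S), lam ^ K.card) * (1 + lam) ^ S.card) :=
        mul_le_mul_of_nonneg_left h1 (by positivity)
    _ = (1 + lam) ^ S.card * (lam ^ T.card *
        ∑ K ∈ (indepSets G).filter (fun I => Disjoint I S), lam ^ K.card) := by ring
    _ ≤ _ := mul_le_mul_of_nonneg_left h2 (by positivity)

/-- A boundary condition witnessing that `v` is not good. -/
theorem exists_boundary_of_not_isGood {G : SimpleGraph V} {v : V} (hv : ¬ IsGood G v) :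
    ∃ T : Finset V, T.card ≤ 1 ∧ (∀ x ∈ T, x ≠ v ∧ ¬ G.Adj v x) ∧
      (∃ u, G.Adj v u ∧ ∀ x ∈ T, ¬ G.Adj u x) ∧
      ((∃ u u', G.Adj v u ∧ G.Adj v u' ∧ G.Adj u u') ∨ ∃ u, G.Adj v u ∧ ∃ x ∈ T, G.Adj u x) := by
  by_cases h : ∃ u u', G.Adj v u ∧ G.Adj v u' ∧ G.Adj u u'
  · obtain ⟨u, hu⟩ := id h
    exact ⟨∅, by simp, by simp, ⟨u, hu.choose_spec.1, by simp⟩, Or.inl h⟩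
  · have h1 : ∀ u u', G.Adj v u → G.Adj v u' → ¬ G.Adj u u' := by
      intro u u' a b c
      exact h ⟨u, u', a, b, c⟩
    have h2 : ¬ ∀ u u' w, G.Adj v u → G.Adj v u' → G.Adj u w → G.Adj u' w :=
      fun h2 => hv ⟨h1, h2⟩
    push Not at h2
    obtain ⟨u, u', w, hu, hu', huw, hu'w⟩ := h2
    -- Without a triangle at `v`, the single vertex `w` blocks `u` and leaves `u'` available, so the
    -- compatible family is neither trivial nor full.
    refine ⟨{w}, by simp, ?_, ⟨u', hu', by simpa using hu'w⟩,
      Or.inr ⟨u, hu, w, by simp, huw⟩⟩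
    simp only [mem_singleton, forall_eq]
    exact ⟨fun h => hu'w (h ▸ hu'.symm), fun h => h1 u w hu h huw⟩

theorem card_biUnion_nb_le {G : SimpleGraph V} {d : ℕ} (hG : ∀ v, (nb G v).card = d)
    (U : Finset V) : (U.biUnion (nb G)).card ≤ U.card * d :=
  card_biUnion_le_card_mul _ _ _ fun v _ => (hG v).le

/-- Every independent set meeting `S` exactly in `T` is a boundary condition with size gap at least
`lam ^ (d + 1)` by `pow_le_sizeGap`. The other factors are the price of prescribing the trace on
`S`: `|S| ≤ d² + 2d + 2`, and `lam / (1 + lam)` is below `lam ^ T.card` for both possible sizes of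
`T`. -/
theorem indGap_ge_of_not_isGood {G : SimpleGraph V} {d : ℕ} (hG : ∀ v, (nb G v).card = d)
    {lam : ℝ} (hlam : 0 ≤ lam) {v : V} (hv : ¬ IsGood G v) :
    lam ^ (d + 2) / (1 + lam) ^ (d * d + 2 * d + 3) * zInd G lam ≤ indGap G lam v := by
  obtain ⟨T, hT1, hT2, ⟨u, hu, huT⟩, hT3⟩ := exists_boundary_of_not_isGood hv
  -- `S` contains every vertex that can interact with `N(v)`, so the trace on `S` decides the
  -- compatible family, and it contains `N(T)`, as `zInd_le_sum_inter_eq` requires.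
  set S : Finset V := insert v (nb G v) ∪ (nb G v).biUnion (nb G) ∪ (T ∪ T.biUnion (nb G)) with hS
  have hSc : S.card ≤ d * d + 2 * d + 2 := by
    have h1 := card_biUnion_nb_le hG (nb G v)
    have h2 := card_biUnion_nb_le hG T
    have h3 := card_insert_le v (nb G v)
    rw [hG] at h1 h3
    have h4 : T.card * d ≤ 1 * d := Nat.mul_le_mul_right d hT1
    have h5 := card_union_le (insert v (nb G v) ∪ (nb G v).biUnion (nb G)) (T ∪ T.biUnion (nb G))
    have h6 := card_union_le (insert v (nb G v)) ((nb G v).biUnion (nb G))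
    have h7 := card_union_le T (T.biUnion (nb G))
    rw [← hS] at h5
    linarith
  have hTS : T ⊆ S := fun x hx => by simp [hS, hx]
  have hTi : T ∈ indepSets G := mem_indepSets.2 fun x hx y hy hxy =>
    hxy.ne (card_le_one.1 hT1 x hx y hy)
  have hp := zInd_le_sum_inter_eq hlam hTS hTi fun x hx y hxy => by
    simp only [hS, mem_union, mem_biUnion, mem_nb]
    exact Or.inr (Or.inr ⟨x, hx, hxy⟩)
  have hgap : lam ^ (d + 1) * ∑ I ∈ (indepSets G).filter (fun I => I ∩ S = T), lam ^ I.card ≤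
      indGap G lam v := by
    rw [mul_sum]
    refine sum_le_sum_of_injOn id ?_ (Set.injOn_id _) ?_ fun J hJ => mul_nonneg (by positivity)
      (sizeGap_nonneg (empty_mem_innerSets hJ) innerSets_subset innerSets_down hlam)
    · intro I hI
      obtain ⟨hI, hIS⟩ := mem_filter.1 hI
      refine mem_outerSets.2 ⟨hI, fun x hx => ?_⟩
      by_cases hxS : x ∈ S
      · exact hT2 x (hIS ▸ mem_inter.2 ⟨hx, hxS⟩)
      · simp only [hS, mem_union, mem_insert, mem_nb, not_or] at hxS
        exact hxS.1.1
    · intro I hI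
      obtain ⟨hI, hIS⟩ := mem_filter.1 hI
      have hIT : ∀ x ∈ I, ∀ u, G.Adj v u → G.Adj u x → x ∈ T := fun x hx u hu hux => by
        rw [← hIS]
        refine mem_inter.2 ⟨hx, ?_⟩
        simp only [hS, mem_union, mem_biUnion, mem_nb]
        exact Or.inl (Or.inr ⟨u, hu, hux⟩)
      have hTI : T ⊆ I := hIS ▸ inter_subset_left
      have hx : {u} ∈ innerSets G v I := by
        refine mem_innerSets.2 ⟨by simpa using hu, mem_indepSets.2 fun x hx y hy hxy => ?_⟩
        rw [mem_union, mem_singleton] at hx hy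
        rcases hx with rfl | hx <;> rcases hy with rfl | hy
        · exact hxy.ne rfl
        · exact huT y (hIT y hy x hu hxy) hxy
        · exact huT x (hIT x hx y hu hxy.symm) hxy.symm
        · exact mem_indepSets.1 hI x hx y hy hxy
      have hfull : nb G v ∉ innerSets G v I := by
        intro hf
        have hf := mem_indepSets.1 (mem_innerSets.1 hf).2
        rcases hT3 with ⟨a, b, ha, hb, hab⟩ | ⟨a, ha, x, hx, hax⟩
        · exact hf a (by simp [ha]) b (by simp [hb]) hab
        · exact hf a (by simp [ha]) x (mem_union_right _ (hTI hx)) hax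
      have := pow_le_sizeGap innerSets_subset innerSets_down hlam hx hfull
      rw [hG] at this ⊢
      rw [mul_comm]
      exact mul_le_mul_of_nonneg_left this (by positivity)
  have hs : (1 : ℝ) ≤ 1 + lam := by linarith
  have hTl : lam / (1 + lam) ≤ lam ^ T.card := by
    rw [div_le_iff₀ (by positivity)]
    interval_cases T.card
    · simp
    · nlinarith
  have hZ := zInd_pos G hlam
  have hSp : (1 + lam) ^ S.card ≤ (1 + lam) ^ (d * d + 2 * d + 2) := pow_le_pow_right₀ hs hSc
  set R := ∑ I ∈ (indepSets G).filter (fun I => I ∩ S = T), lam ^ I.card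
  have hR : 0 ≤ R := sum_nonneg fun _ _ => by positivity
  refine le_trans ?_ hgap
  have h1 : lam / (1 + lam) * zInd G lam ≤ (1 + lam) ^ (d * d + 2 * d + 2) * R :=
    ((mul_le_mul_of_nonneg_right hTl hZ.le).trans hp).trans (mul_le_mul_of_nonneg_right hSp hR)
  rw [pow_succ lam (d + 1), mul_div_assoc, mul_assoc]
  refine mul_le_mul_of_nonneg_left ?_ (by positivity)
  rw [pow_succ (1 + lam) (d * d + 2 * d + 2), div_mul_eq_mul_div, div_le_iff₀ (by positivity)]
  have h2 := mul_le_mul_of_nonneg_right h1 (show 0 ≤ 1 + lam by positivity)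
  have h3 : lam / (1 + lam) * zInd G lam * (1 + lam) = lam * zInd G lam := by field_simp
  linarith

/-- The number of vertices that are not good. -/
noncomputable def badCount (G : SimpleGraph V) : ℕ := (univ.filter fun v => ¬ IsGood G v).card

/-- Stability for the hard-core model in terms of the fraction of vertices that are not good. -/
theorem alphaInd_le [Nonempty V] {G : SimpleGraph V} {d : ℕ} (hd : 1 ≤ d)
    (hG : ∀ v, (nb G v).card = d) {lam : ℝ} (hlam : 0 ≤ lam) :
    alphaInd G lam ≤ alphaInd (Kdd d) lam -
      lam ^ (d + 2) / (1 + lam) ^ (d * d + 2 * d + 3) / (d * (2 * (1 + lam) ^ d - 1)) *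
        (badCount G / Fintype.card V) := by
  have h1 := sum_indGap hd hG hlam
  have h2 := alphaInd_Kdd hd hlam
  set κ := lam ^ (d + 2) / (1 + lam) ^ (d * d + 2 * d + 3)
  have h3 : badCount G * (κ * zInd G lam) ≤ ∑ v, indGap G lam v := by
    rw [badCount, ← nsmul_eq_mul, ← sum_const]
    exact (sum_le_sum fun v hv => indGap_ge_of_not_isGood hG hlam (mem_filter.1 hv).2).trans
      (sum_le_sum_of_subset_of_nonneg (subset_univ _) fun v _ _ => indGap_nonneg G hlam v)
  have hZ := zInd_pos G hlam
  have hn : (0 : ℝ) < Fintype.card V := by exact_mod_cast Fintype.card_pos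
  have hd' : (0 : ℝ) < d := by exact_mod_cast hd
  have hs : (1 : ℝ) ≤ (1 + lam) ^ d := one_le_pow₀ (by linarith)
  have hE : 0 < 2 * (1 + lam) ^ d - 1 := by linarith
  rw [h1, ← h2] at h3
  have h4 : badCount G * κ ≤ d * Fintype.card V * ((2 * (1 + lam) ^ d - 1) *
      (alphaInd (Kdd d) lam - alphaInd G lam)) := by
    refine le_of_mul_le_mul_right ?_ hZ
    linarith
  rw [le_sub_comm, div_mul_div_comm, div_le_iff₀ (by positivity)]
  linarith

end HardCore

end OccStability

/-! ### The monomer-dimer model: expansions around a vertex or a dart -/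

namespace OccStability

open scoped Classical

section Matchings

open Finset

variable {V : Type*}

/-- The vertex `x` is not covered by the edge set `M`. -/
def Uncov (M : Finset (Sym2 V)) (x : V) : Prop := ∀ e ∈ M, x ∉ e

theorem uncov_insert {M : Finset (Sym2 V)} {v y x : V} :
    Uncov (insert s(v, y) M) x ↔ x ≠ v ∧ x ≠ y ∧ Uncov M x := by
  simp [Uncov, and_assoc]

theorem Uncov.notMem {M : Finset (Sym2 V)} {v : V} (h : Uncov M v) (y : V) : s(v, y) ∉ M :=
  fun hm => h _ hm (by simp)

/-- The edges of `M` meeting `S`. -/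
noncomputable def touching (M : Finset (Sym2 V)) (S : Finset V) : Finset (Sym2 V) :=
  M.filter fun e => ∃ x ∈ S, x ∈ e

theorem uncov_of_touching {M : Finset (Sym2 V)} {S : Finset V} {x : V} (hx : x ∈ S)
    (h : Uncov (touching M S) x) : Uncov M x := fun e he hxe =>
  h e (mem_filter.2 ⟨he, x, hx, hxe⟩) hxe

variable [Fintype V]

theorem mem_matchings {G : SimpleGraph V} {M : Finset (Sym2 V)} :
    M ∈ matchings G ↔ (∀ e ∈ M, e ∈ G.edgeSet) ∧
      ∀ e ∈ M, ∀ f ∈ M, ∀ v, v ∈ e → v ∈ f → e = f := by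
  simp [matchings, subset_iff]

theorem matchings_mono {G : SimpleGraph V} {M N : Finset (Sym2 V)} (h : M ∈ matchings G)
    (hN : N ⊆ M) : N ∈ matchings G :=
  mem_matchings.2 ⟨fun e he => (mem_matchings.1 h).1 e (hN he),
    fun e he f hf => (mem_matchings.1 h).2 e (hN he) f (hN hf)⟩

theorem zMatch_pos (G : SimpleGraph V) {lam : ℝ} (hlam : 0 ≤ lam) : 0 < zMatch G lam :=
  sum_pos' (fun I _ => by positivity) ⟨∅, mem_matchings.2 (by simp), by simp⟩

theorem insert_mem_matchings {G : SimpleGraph V} {M : Finset (Sym2 V)} (hM : M ∈ matchings G)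
    {v y : V} (hvy : G.Adj v y) (hv : Uncov M v) (hy : Uncov M y) :
    insert s(v, y) M ∈ matchings G := by
  obtain ⟨h1, h2⟩ := mem_matchings.1 hM
  have key : ∀ f ∈ M, ∀ x, x ∈ s(v, y) → x ∉ f := fun f hf x hx hxf => by
    rcases Sym2.mem_iff.1 hx with rfl | rfl
    · exact hv f hf hxf
    · exact hy f hf hxf
  refine mem_matchings.2 ⟨fun e he => ?_, fun e he f hf x hxe hxf => ?_⟩
  · rcases mem_insert.1 he with rfl | he
    · exact hvy
    · exact h1 e he
  · rcases mem_insert.1 he with rfl | he' <;> rcases mem_insert.1 hf with rfl | hf'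
    · rfl
    · exact absurd hxf (key f hf' x hxe)
    · exact absurd hxe (key e he' x hxf)
    · exact h2 e he' f hf' x hxe hxf

/-- Matchings of `G` covering no vertex of `U`. -/
noncomputable def avoiding (G : SimpleGraph V) (U : Finset V) : Finset (Finset (Sym2 V)) :=
  (matchings G).filter fun M => ∀ x ∈ U, Uncov M x

theorem mem_avoiding {G : SimpleGraph V} {U : Finset V} {M : Finset (Sym2 V)} :
    M ∈ avoiding G U ↔ M ∈ matchings G ∧ ∀ x ∈ U, Uncov M x := by simp [avoiding]

theorem avoiding_insert (G : SimpleGraph V) (U : Finset V) (v : V) :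
    avoiding G (insert v U) = (avoiding G U).filter fun M => Uncov M v := by
  ext M
  simp only [mem_avoiding, mem_filter, mem_insert, forall_eq_or_imp]
  tauto

/-- The uncovered neighbours of `v` outside `U`. -/
noncomputable def freeNb (G : SimpleGraph V) (M : Finset (Sym2 V)) (v : V) (U : Finset V) :
    Finset V := (nb G v).filter fun y => y ∉ U ∧ Uncov M y

theorem mem_freeNb {G : SimpleGraph V} {M : Finset (Sym2 V)} {v y : V} {U : Finset V} :
    y ∈ freeNb G M v U ↔ G.Adj v y ∧ y ∉ U ∧ Uncov M y := by simp [freeNb]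

/-- Deleting the edge `vy` is a bijection onto the matchings that also avoid both of its ends. -/
theorem sum_edge_mem {G : SimpleGraph V} {U : Finset V} {v y : V} (hv : v ∉ U) (hy : y ∉ U)
    (hvy : G.Adj v y) (φ : Finset (Sym2 V) → ℝ) :
    ∑ M ∈ (avoiding G U).filter (fun M => s(v, y) ∈ M), φ M =
      ∑ M ∈ avoiding G (insert y (insert v U)), φ (insert s(v, y) M) := by
  refine sum_nbij' (fun M => M.erase s(v, y)) (fun M => insert s(v, y) M) ?_ ?_ ?_ ?_ ?_
  · intro M hM
    obtain ⟨hM, he⟩ := mem_filter.1 hM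
    obtain ⟨hM, hU⟩ := mem_avoiding.1 hM
    have key : ∀ x, x ∈ s(v, y) → Uncov (M.erase s(v, y)) x := fun x hx f hf hxf =>
      (mem_erase.1 hf).1 ((mem_matchings.1 hM).2 f (mem_erase.1 hf).2 _ he x hxf hx)
    refine mem_avoiding.2 ⟨matchings_mono hM (erase_subset _ _), fun x hx => ?_⟩
    rcases mem_insert.1 hx with rfl | hx
    · exact key _ (by simp)
    rcases mem_insert.1 hx with rfl | hx
    · exact key _ (by simp)
    exact fun e he => hU x hx e (mem_erase.1 he).2
  · intro M hM
    obtain ⟨hM, hU⟩ := mem_avoiding.1 hM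
    refine mem_filter.2 ⟨mem_avoiding.2 ⟨insert_mem_matchings hM hvy (hU v (by simp))
      (hU y (by simp)), fun x hx => uncov_insert.2 ⟨?_, ?_, hU x (by simp [hx])⟩⟩,
      mem_insert_self _ _⟩
    · rintro rfl; exact hv hx
    · rintro rfl; exact hy hx
  · intro M hM
    exact insert_erase (mem_filter.1 hM).2
  · intro M hM
    exact erase_insert (((mem_avoiding.1 hM).2 v (by simp)).notMem y)
  · intro M hM
    rw [insert_erase (mem_filter.1 hM).2]

/-- Splitting the matchings avoiding `U` according to the status of `v`. -/
theorem sum_avoiding {G : SimpleGraph V} {U : Finset V} {v : V} (hv : v ∉ U)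
    (φ : Finset (Sym2 V) → ℝ) :
    ∑ M ∈ avoiding G U, φ M = ∑ M ∈ avoiding G (insert v U),
      (φ M + ∑ y ∈ freeNb G M v U, φ (insert s(v, y) M)) := by
  have hpt : ∀ M ∈ avoiding G U, φ M = (if Uncov M v then φ M else 0) +
      ∑ y ∈ nb G v \ U, if s(v, y) ∈ M then φ M else 0 := by
    intro M hM
    obtain ⟨hM, hU⟩ := mem_avoiding.1 hM
    by_cases h : Uncov M v
    · rw [if_pos h, sum_eq_zero fun y _ => if_neg (h.notMem y), add_zero]
    · rw [if_neg h, zero_add]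
      unfold Uncov at h
      push Not at h
      obtain ⟨e, he, hve⟩ := h
      obtain ⟨y, rfl⟩ := Sym2.mem_iff_exists.1 hve
      have hadj : G.Adj v y := (mem_matchings.1 hM).1 _ he
      rw [sum_eq_single y, if_pos he]
      · intro z _ hz
        refine if_neg fun hz' => hz ?_
        have := (mem_matchings.1 hM).2 _ hz' _ he v (by simp) (by simp)
        exact Sym2.congr_right.1 this
      · intro hy
        refine absurd (mem_sdiff.2 ⟨mem_nb.2 hadj, fun hyU => ?_⟩) hy
        exact hU y hyU _ he (by simp)
  rw [sum_congr rfl hpt, sum_add_distrib, sum_add_distrib, ← sum_filter, ← avoiding_insert]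
  congr 1
  rw [sum_comm]
  have h1 : ∀ y ∈ nb G v \ U, ∑ M ∈ avoiding G U, (if s(v, y) ∈ M then φ M else 0) =
      ∑ M ∈ avoiding G (insert v U), if Uncov M y then φ (insert s(v, y) M) else 0 := by
    intro y hy
    rw [mem_sdiff, mem_nb] at hy
    rw [← sum_filter, sum_edge_mem hv hy.2 hy.1, avoiding_insert, sum_filter]
  rw [sum_congr rfl h1, sum_comm]
  refine sum_congr rfl fun M _ => ?_
  rw [← sum_filter]
  refine sum_congr ?_ fun _ _ => rfl
  ext y
  simp [mem_freeNb, and_assoc]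

/-- The number of uncovered neighbours of `u` other than `v`. -/
noncomputable def freeCount (G : SimpleGraph V) (M : Finset (Sym2 V)) (u v : V) : ℕ :=
  (freeNb G M u {v}).card

/-- The number of uncovered common neighbours of `u` and `v`. -/
noncomputable def commonCount (G : SimpleGraph V) (M : Finset (Sym2 V)) (u v : V) : ℕ :=
  (freeNb G M u {v} ∩ freeNb G M v {u}).card

/-- Matchings covering neither `u` nor `v`. -/
noncomputable def avoidPair (G : SimpleGraph V) (u v : V) : Finset (Finset (Sym2 V)) :=
  avoiding G {v, u}

theorem mem_avoidPair {G : SimpleGraph V} {u v : V} {M : Finset (Sym2 V)} :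
    M ∈ avoidPair G u v ↔ M ∈ matchings G ∧ Uncov M v ∧ Uncov M u := by
  simp [avoidPair, mem_avoiding]

theorem avoidPair_comm (G : SimpleGraph V) (u v : V) : avoidPair G u v = avoidPair G v u := by
  ext M; simp only [mem_avoidPair]; tauto

theorem commonCount_comm (G : SimpleGraph V) (M : Finset (Sym2 V)) (u v : V) :
    commonCount G M u v = commonCount G M v u := by
  rw [commonCount, inter_comm, commonCount]

theorem commonCount_le (G : SimpleGraph V) (M : Finset (Sym2 V)) (u v : V) :
    commonCount G M u v ≤ freeCount G M u v := card_le_card inter_subset_left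

theorem freeNb_empty_eq {G : SimpleGraph V} {M : Finset (Sym2 V)} {u v : V} (huv : G.Adj u v)
    (hv : Uncov M v) : freeNb G M u ∅ = insert v (freeNb G M u {v}) := by
  ext y
  simp only [mem_freeNb, mem_insert, mem_singleton, notMem_empty, not_false_eq_true, true_and]
  by_cases h : y = v
  · subst h; simp [huv, hv]
  · simp [h]

theorem card_freeNb_empty {G : SimpleGraph V} {M : Finset (Sym2 V)} {u v : V} (huv : G.Adj u v)
    (hv : Uncov M v) : (freeNb G M u ∅).card = freeCount G M u v + 1 := by
  rw [freeNb_empty_eq huv hv, card_insert_of_notMem (by simp [mem_freeNb]), freeCount]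

theorem freeNb_insert {G : SimpleGraph V} {M : Finset (Sym2 V)} {u v y : V} :
    freeNb G (insert s(v, y) M) u ∅ = (freeNb G M u {v}).erase y := by
  ext x
  simp only [mem_freeNb, mem_erase, uncov_insert, mem_singleton, notMem_empty,
    not_false_eq_true, true_and]
  tauto

/-- Matching `v` to `y` costs `u` a free neighbour exactly when `y` is a common one. The truncated
subtraction is harmless: its coefficient vanishes when there are no common neighbours. -/
theorem sum_freeNb {G : SimpleGraph V} (M : Finset (Sym2 V)) (u v : V) (h : ℕ → ℝ) :
    ∑ y ∈ freeNb G M v {u}, h ((freeNb G M u {v}).erase y).card =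
      ((freeCount G M v u : ℝ) - commonCount G M u v) * h (freeCount G M u v)
        + commonCount G M u v * h (freeCount G M u v - 1) := by
  rw [← sum_filter_add_sum_filter_not _ (fun y => y ∈ freeNb G M u {v})]
  have h1 : (freeNb G M v {u}).filter (fun y => y ∈ freeNb G M u {v}) =
      freeNb G M u {v} ∩ freeNb G M v {u} := by rw [filter_mem_eq_inter, inter_comm]
  have h2 : (((freeNb G M v {u}).filter fun y => y ∉ freeNb G M u {v}).card : ℝ) =
      (freeCount G M v u : ℝ) - commonCount G M u v := by
    rw [eq_sub_iff_add_eq, commonCount, ← h1, freeCount, add_comm]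
    exact_mod_cast card_filter_add_card_filter_not _
  rw [sum_congr rfl fun y hy => by rw [card_erase_of_mem (mem_filter.1 hy).2],
    sum_congr (s₁ := (freeNb G M v {u}).filter fun y => y ∉ freeNb G M u {v}) rfl
      fun y hy => by rw [erase_eq_of_notMem (mem_filter.1 hy).2],
    sum_const, sum_const, nsmul_eq_mul, nsmul_eq_mul, h2, h1, add_comm]
  rfl

theorem freeNb_empty_eq_filter (G : SimpleGraph V) (M : Finset (Sym2 V)) (u : V) :
    freeNb G M u ∅ = (nb G u).filter (Uncov M) := by
  ext y; simp [mem_freeNb]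

/-- Sums over matchings avoiding `u`, conditioned on what happens at a neighbour `v`. -/
theorem sum_avoiding_singleton {G : SimpleGraph V} {u v : V} (huv : G.Adj u v) (lam : ℝ)
    (h : ℕ → ℝ) :
    ∑ M ∈ avoiding G {u}, lam ^ M.card * h (freeNb G M u ∅).card =
      ∑ M ∈ avoidPair G u v, lam ^ M.card * (h (freeCount G M u v + 1) +
        lam * (((freeCount G M v u : ℝ) - commonCount G M u v) * h (freeCount G M u v)
          + commonCount G M u v * h (freeCount G M u v - 1))) := by
  rw [sum_avoiding (v := v) (by simpa using huv.ne')]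
  refine sum_congr rfl fun M hM => ?_
  obtain ⟨_, hv, _⟩ := mem_avoidPair.1 hM
  rw [card_freeNb_empty huv hv, ← sum_freeNb, mul_add, mul_sum, mul_sum]
  congr 1
  refine sum_congr rfl fun y _ => ?_
  rw [freeNb_insert, card_insert_of_notMem (hv.notMem y), pow_succ]
  ring

theorem zMatch_eq_sum_avoiding (G : SimpleGraph V) (lam : ℝ) (u : V) :
    zMatch G lam = ∑ M ∈ avoiding G {u}, lam ^ M.card * (1 + lam * (freeNb G M u ∅).card) := by
  have h0 : matchings G = avoiding G ∅ := by ext M; simp [mem_avoiding]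
  rw [zMatch, h0, sum_avoiding (v := u) (by simp)]
  refine sum_congr rfl fun M hM => ?_
  have hu : Uncov M u := (mem_avoiding.1 hM).2 u (by simp)
  rw [sum_congr rfl fun y _ => by rw [card_insert_of_notMem (hu.notMem y)], sum_const,
    nsmul_eq_mul, pow_succ]
  ring

/-- The partition function in terms of the local view of the edge `uv`. -/
theorem zMatch_eq_sum_avoidPair {G : SimpleGraph V} {u v : V} (huv : G.Adj u v) (lam : ℝ) :
    zMatch G lam = ∑ M ∈ avoidPair G u v, lam ^ M.card *
      (1 + lam + lam * (freeCount G M u v + freeCount G M v u) +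
        lam ^ 2 * (freeCount G M u v * freeCount G M v u - commonCount G M u v)) := by
  rw [zMatch_eq_sum_avoiding G lam u, sum_avoiding_singleton huv lam fun t => 1 + lam * t]
  refine sum_congr rfl fun M _ => ?_
  have hc := commonCount_le G M u v
  rcases Nat.eq_zero_or_pos (commonCount G M u v) with h | h
  · rw [h]; push_cast; ring
  · rw [Nat.cast_sub (by omega)]; push_cast; ring

/-- Counts pairs of a matching avoiding `u` and a free neighbour `v` of `u`; since `v` is itself
free, `u` has `freeCount + 1` free neighbours. -/
theorem sum_avoiding_mul_card {G : SimpleGraph V} (u : V) (lam : ℝ) (f : ℕ → ℝ) :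
    ∑ M ∈ avoiding G {u}, lam ^ M.card * (((freeNb G M u ∅).card : ℝ) * f (freeNb G M u ∅).card) =
      ∑ v ∈ nb G u, ∑ M ∈ avoidPair G u v, lam ^ M.card * f (freeCount G M u v + 1) := by
  have h1 : ∀ v ∈ nb G u, ∑ M ∈ avoidPair G u v, lam ^ M.card * f (freeCount G M u v + 1) =
      ∑ M ∈ avoiding G {u}, if Uncov M v then lam ^ M.card * f (freeNb G M u ∅).card else 0 := by
    intro v hv
    rw [← sum_filter, ← avoiding_insert]
    refine sum_congr rfl fun M hM => ?_
    rw [card_freeNb_empty (mem_nb.1 hv) (mem_avoidPair.1 hM).2.1]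
  rw [sum_congr rfl h1, sum_comm]
  refine sum_congr rfl fun M _ => ?_
  rw [← sum_filter, sum_const, nsmul_eq_mul]
  rw [freeNb_empty_eq_filter]
  ring

/-- The local stationarity relation at the edge `uv`, tested against `f`. -/
noncomputable def flow (G : SimpleGraph V) (lam : ℝ) (f : ℕ → ℝ) (M : Finset (Sym2 V))
    (u v : V) : ℝ :=
  ((nb G u).card - (freeCount G M u v + 1 : ℕ)) * f (freeCount G M u v + 1) -
    lam * (((freeCount G M v u : ℝ) - commonCount G M u v) *
        (freeCount G M u v * f (freeCount G M u v))
      + commonCount G M u v * ((freeCount G M u v - 1 : ℕ) * f (freeCount G M u v - 1)))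

/-- The weighted sum of `t * f t`, with `t` the number of free neighbours of `u`, is computed in two
ways: by marking a free neighbour, and by conditioning on the status of a fixed neighbour `v`.
Summing the second over all `v` gives degree many copies of the first. -/
theorem sum_flow (G : SimpleGraph V) (lam : ℝ) (f : ℕ → ℝ) (u : V) :
    ∑ v ∈ nb G u, ∑ M ∈ avoidPair G u v, lam ^ M.card * flow G lam f M u v = 0 := by
  have h1 := sum_avoiding_mul_card (G := G) u lam f
  have h2 : ∀ v ∈ nb G u, ∑ M ∈ avoidPair G u v, lam ^ M.card * flow G lam f M u v =
      (nb G u).card * ∑ M ∈ avoidPair G u v, lam ^ M.card * f (freeCount G M u v + 1)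
      - ∑ M ∈ avoiding G {u}, lam ^ M.card *
        (((freeNb G M u ∅).card : ℝ) * f (freeNb G M u ∅).card) := by
    intro v hv
    rw [sum_avoiding_singleton (mem_nb.1 hv) lam fun t => (t : ℝ) * f t, mul_sum,
      ← sum_sub_distrib]
    refine sum_congr rfl fun M _ => ?_
    rw [flow]
    ring
  rw [sum_congr rfl h2, sum_sub_distrib, ← mul_sum, ← h1, sum_const, nsmul_eq_mul, sub_self]

theorem sum_nb_comm (G : SimpleGraph V) (Y : V → V → ℝ) :
    ∑ u, ∑ v ∈ nb G u, Y u v = ∑ u, ∑ v ∈ nb G u, Y v u := by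
  have : ∀ Y : V → V → ℝ, ∑ u, ∑ v ∈ nb G u, Y u v = ∑ u, ∑ v, if G.Adj u v then Y u v else 0 :=
    fun Y => sum_congr rfl fun u _ => by rw [nb, sum_filter]
  rw [this, this, sum_comm]
  simp only [G.adj_comm]

theorem sum_flow_swap (G : SimpleGraph V) (lam : ℝ) (f : ℕ → ℝ) :
    ∑ u, ∑ v ∈ nb G u, ∑ M ∈ avoidPair G u v, lam ^ M.card * flow G lam f M v u = 0 := by
  rw [sum_nb_comm]
  refine sum_eq_zero fun u _ => ?_
  rw [← sum_flow G lam f u]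
  exact sum_congr rfl fun v _ => by rw [avoidPair_comm]

/-- Counting darts over a set of edges. -/
theorem sum_nb_edge_mem {G : SimpleGraph V} {M : Finset (Sym2 V)} (hM : ∀ e ∈ M, e ∈ G.edgeSet) :
    ∑ u, ∑ v ∈ nb G u, (if s(u, v) ∈ M then 1 else 0 : ℝ) = 2 * M.card := by
  have h1 : ∀ u, ∑ v ∈ nb G u, (if s(u, v) ∈ M then 1 else 0 : ℝ) =
      ∑ v, if s(u, v) ∈ M then 1 else 0 := fun u => by
    refine sum_subset (subset_univ _) fun v _ hv => if_neg fun h => hv (mem_nb.2 (hM _ h))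
  simp only [h1]
  rw [← Fintype.sum_prod_type' (f := fun u v => if s(u, v) ∈ M then (1 : ℝ) else 0)]
  have h2 : ∀ p : V × V, (if s(p.1, p.2) ∈ M then 1 else 0 : ℝ) =
      ∑ e ∈ M, if s(p.1, p.2) = e then 1 else 0 := fun p => by rw [sum_ite_eq]
  simp only [h2]
  rw [sum_comm, mul_comm, ← nsmul_eq_mul, ← sum_const]
  refine sum_congr rfl fun e he => ?_
  induction e using Sym2.ind with
  | _ a b =>
    have hab : a ≠ b := (SimpleGraph.mem_edgeSet G |>.1 (hM _ he)).ne
    have : (univ.filter fun p : V × V => s(p.1, p.2) = s(a, b)) = {(a, b), (b, a)} := by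
      ext ⟨x, y⟩
      simp
    rw [← sum_filter, this, sum_pair (by simp [hab])]
    norm_num

theorem two_mul_card_edgeFinset {G : SimpleGraph V} {d : ℕ} (hG : ∀ v, (nb G v).card = d) :
    2 * (G.edgeFinset.card : ℝ) = d * Fintype.card V := by
  rw [← sum_nb_edge_mem (G := G) (M := G.edgeFinset) (by simp)]
  have : ∀ u, ∑ v ∈ nb G u, (if s(u, v) ∈ G.edgeFinset then 1 else 0 : ℝ) = d := fun u => by
    rw [sum_congr rfl fun v hv => if_pos (by simpa using hv), sum_const, hG]
    simp
  simp only [this, sum_const, card_univ, nsmul_eq_mul]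
  ring

/-! ### Linear programming duality for the matching occupancy fraction -/

/-- Total weight of pairs of a dart and a matching avoiding it. -/
noncomputable def dartWeight (G : SimpleGraph V) (lam : ℝ) : ℝ :=
  ∑ u, ∑ v ∈ nb G u, ∑ M ∈ avoidPair G u v, lam ^ M.card

theorem sum_edge_mem_matchings {G : SimpleGraph V} {u v : V} (huv : G.Adj u v) (lam : ℝ) :
    lam * ∑ M ∈ avoidPair G u v, lam ^ M.card =
      ∑ M ∈ matchings G, (if s(u, v) ∈ M then 1 else 0) * lam ^ M.card := by
  have h0 : matchings G = avoiding G ∅ := by ext M; simp [mem_avoiding]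
  have h1 := sum_edge_mem (U := ∅) (by simp) (by simp) huv fun M => lam ^ M.card
  rw [insert_empty_eq, ← h0, sum_filter] at h1
  simp only [ite_mul, one_mul, zero_mul]
  rw [h1, mul_sum]
  refine sum_congr rfl fun M hM => ?_
  rw [card_insert_of_notMem ((mem_avoidPair.1 hM).2.2.notMem v), pow_succ']

theorem mul_dartWeight_eq_sum (G : SimpleGraph V) (lam : ℝ) :
    lam * dartWeight G lam = 2 * ∑ M ∈ matchings G, (M.card : ℝ) * lam ^ M.card := by
  have h1 : lam * dartWeight G lam = ∑ u, ∑ v ∈ nb G u, ∑ M ∈ matchings G,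
      (if s(u, v) ∈ M then 1 else 0) * lam ^ M.card := by
    rw [dartWeight, mul_sum]
    refine sum_congr rfl fun u _ => ?_
    rw [mul_sum]
    exact sum_congr rfl fun v hv => sum_edge_mem_matchings (mem_nb.1 hv) lam
  have h2 : ∀ u, ∑ v ∈ nb G u, ∑ M ∈ matchings G,
      (if s(u, v) ∈ M then 1 else 0) * lam ^ M.card = ∑ M ∈ matchings G, ∑ v ∈ nb G u,
      (if s(u, v) ∈ M then 1 else 0) * lam ^ M.card := fun u => sum_comm
  rw [h1, sum_congr rfl fun u _ => h2 u, sum_comm, mul_sum]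
  refine sum_congr rfl fun M hM => ?_
  rw [← mul_assoc, ← sum_nb_edge_mem (mem_matchings.1 hM).1]
  simp only [sum_mul]

/-- Inserting the edge of the dart turns a pair into a matching with a marked oriented edge, whose
total weight is twice the unnormalised mean size. -/
theorem mul_dartWeight [Nonempty V] {G : SimpleGraph V} {d : ℕ} (hd : 1 ≤ d)
    (hG : ∀ v, (nb G v).card = d) {lam : ℝ} (hlam : 0 ≤ lam) :
    lam * dartWeight G lam = d * Fintype.card V * alphaMatch G lam * zMatch G lam := by
  have h3 := two_mul_card_edgeFinset hG
  have hn : (0 : ℝ) < Fintype.card V := by exact_mod_cast Fintype.card_pos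
  have hd' : (0 : ℝ) < d := by exact_mod_cast hd
  have hE : (G.edgeFinset.card : ℝ) ≠ 0 := fun h => by
    rw [h] at h3
    have := mul_pos hd' hn
    linarith
  have hZ := (zMatch_pos G hlam).ne'
  rw [mul_dartWeight_eq_sum, alphaMatch, ← h3]
  simp only [← mul_div_assoc, ← sum_div]
  generalize ∑ M ∈ matchings G, (M.card : ℝ) * lam ^ M.card = X
  generalize (G.edgeFinset.card : ℝ) = E at *
  field_simp

/-- The dual test function. -/
noncomputable def testFun (n : ℕ) (lam : ℝ) (t : ℕ) : ℝ := potential n lam t / t - lam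

/-- At `t = 0`, division by zero makes `testFun` equal `-lam`; this does no harm because the
potential vanishes there. -/
theorem mul_testFun (n : ℕ) (lam : ℝ) (t : ℕ) :
    t * testFun n lam t = potential n lam t - lam * t := by
  rcases Nat.eq_zero_or_pos t with rfl | h
  · simp
  · have : (t : ℝ) ≠ 0 := by positivity
    unfold testFun
    field_simp

/-- The dual slack of a local configuration. -/
noncomputable def slack (n : ℕ) (lam : ℝ) (a b c : ℕ) : ℝ :=
  lam / 2 * (((a : ℝ) - b) * (potential n lam b - potential n lam a) +
    c * (potential n lam (a - 1) - potential n lam a +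
      (potential n lam (b - 1) - potential n lam b)))

theorem freeCount_add_one_le (G : SimpleGraph V) (M : Finset (Sym2 V)) {u v : V}
    (huv : G.Adj u v) : freeCount G M u v + 1 ≤ (nb G u).card := by
  have h : freeNb G M u {v} ⊆ (nb G u).erase v := fun y hy => by
    have := mem_freeNb.1 hy
    simp only [mem_singleton] at this
    exact mem_erase.2 ⟨this.2.1, mem_nb.2 this.1⟩
  have h1 := card_le_card h
  have h2 := card_erase_add_one (mem_nb.2 huv)
  rw [freeCount]
  omega

/-- Complementary slackness: the local weight is a flow plus the slack. -/
theorem local_identity {G : SimpleGraph V} {n : ℕ} (hG : ∀ v, (nb G v).card = n + 1) {lam : ℝ}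
    (hlam : 0 < lam) (M : Finset (Sym2 V)) {u v : V} (huv : G.Adj u v) :
    lam * (freeCount G M u v + freeCount G M v u) +
        lam ^ 2 * (freeCount G M u v * freeCount G M v u - commonCount G M u v) =
      lam * (n + chainMean n lam) + 1 / 2 * flow G lam (testFun n lam) M u v +
        1 / 2 * flow G lam (testFun n lam) M v u +
        slack n lam (freeCount G M u v) (freeCount G M v u) (commonCount G M u v) := by
  have ha := freeCount_add_one_le G M huv
  have hb := freeCount_add_one_le G M huv.symm
  have hca := commonCount_le G M u v
  have hcb := commonCount_le G M v u
  rw [hG] at ha hb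
  rw [flow, flow, commonCount_comm G M v u, hG, hG] at *
  generalize freeCount G M u v = a at *
  generalize freeCount G M v u = b at *
  generalize commonCount G M u v = c at *
  have r1 := potential_rec (n := n) (a := a) (by omega) hlam
  have r2 := potential_rec (n := n) (a := b) (by omega) hlam
  simp only [mul_testFun]
  rw [testFun, testFun, slack]
  -- When `c` is positive, `a` and `b` are at least `c`, so `a - 1` and `b - 1` are genuine; when `c
  -- = 0` those terms drop out.
  rcases Nat.eq_zero_or_pos c with rfl | hc
  · push_cast
    linear_combination (-1 / 2) * r1 - 1 / 2 * r2
  · rw [Nat.cast_sub (show 1 ≤ a by omega), Nat.cast_sub (show 1 ≤ b by omega)]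
    push_cast
    linear_combination (-1 / 2) * r1 - 1 / 2 * r2

/-- The accumulated slack over the darts leaving `u`. -/
noncomputable def matchGap (G : SimpleGraph V) (n : ℕ) (lam : ℝ) (u : V) : ℝ :=
  ∑ v ∈ nb G u, ∑ M ∈ avoidPair G u v, lam ^ M.card *
    slack n lam (freeCount G M u v) (freeCount G M v u) (commonCount G M u v)

/-- Expand the partition function at each dart, insert `local_identity` and sum over all darts: both
flow terms cancel, and the constant part multiplies `dartWeight`, hence the occupancy fraction. -/
theorem sum_matchGap [Nonempty V] {G : SimpleGraph V} {n : ℕ} (hG : ∀ v, (nb G v).card = n + 1)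
    {lam : ℝ} (hlam : 0 < lam) :
    lam * ∑ u, matchGap G n lam u = (n + 1) * Fintype.card V * zMatch G lam *
      (lam - (1 + lam + lam * (n + chainMean n lam)) * alphaMatch G lam) := by
  have h1 : ∀ u, ∀ v ∈ nb G u, zMatch G lam = (1 + lam + lam * (n + chainMean n lam)) *
      ∑ M ∈ avoidPair G u v, lam ^ M.card +
      1 / 2 * ∑ M ∈ avoidPair G u v, lam ^ M.card * flow G lam (testFun n lam) M u v +
      1 / 2 * ∑ M ∈ avoidPair G u v, lam ^ M.card * flow G lam (testFun n lam) M v u +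
      ∑ M ∈ avoidPair G u v, lam ^ M.card *
        slack n lam (freeCount G M u v) (freeCount G M v u) (commonCount G M u v) := by
    intro u v hv
    rw [zMatch_eq_sum_avoidPair (mem_nb.1 hv) lam, mul_sum, mul_sum, mul_sum, ← sum_add_distrib,
      ← sum_add_distrib, ← sum_add_distrib]
    refine sum_congr rfl fun M _ => ?_
    linear_combination lam ^ M.card * local_identity hG hlam M (mem_nb.1 hv)
  have h2 : ∑ u, ∑ _v ∈ nb G u, zMatch G lam = (n + 1) * Fintype.card V * zMatch G lam := by
    simp only [sum_const, hG, card_univ, nsmul_eq_mul]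
    push_cast
    ring
  rw [sum_congr rfl fun u _ => sum_congr rfl (h1 u)] at h2
  simp only [sum_add_distrib, ← mul_sum, sum_flow, sum_flow_swap, mul_zero,
    add_zero] at h2
  have h3 := mul_dartWeight (by omega) hG hlam.le
  push_cast at h3
  change (1 + lam + lam * (n + chainMean n lam)) * dartWeight G lam + ∑ u, matchGap G n lam u = _
    at h2
  linear_combination lam * h2 - (1 + lam + lam * (n + chainMean n lam)) * h3

theorem potential_le {n : ℕ} {lam : ℝ} (hlam : 0 < lam) {a b : ℕ} (hab : a ≤ b) (hb : b ≤ n) :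
    potential n lam b ≤ potential n lam a := by
  induction b, hab using Nat.le_induction with
  | base => exact le_rfl
  | succ b _ ih => exact (potential_succ_lt hlam (by omega)).le.trans (ih (by omega))

theorem sub_mul_potential_nonneg {n : ℕ} {lam : ℝ} (hlam : 0 < lam) {a b : ℕ} (ha : a ≤ n)
    (hb : b ≤ n) : 0 ≤ ((a : ℝ) - b) * (potential n lam b - potential n lam a) := by
  rcases le_total a b with h | h
  · exact mul_nonneg_of_nonpos_of_nonpos (sub_nonpos.2 (by exact_mod_cast h))
      (sub_nonpos.2 (potential_le hlam h hb))
  · exact mul_nonneg (sub_nonneg.2 (by exact_mod_cast h)) (sub_nonneg.2 (potential_le hlam h ha))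

theorem potential_pred_sub_nonneg {n : ℕ} {lam : ℝ} (hlam : 0 < lam) {a : ℕ} (ha : a ≤ n) :
    0 ≤ potential n lam (a - 1) - potential n lam a :=
  sub_nonneg.2 (potential_le hlam (Nat.sub_le _ _) ha)

theorem slack_nonneg {n : ℕ} {lam : ℝ} (hlam : 0 < lam) {a b : ℕ} (ha : a ≤ n) (hb : b ≤ n)
    (c : ℕ) : 0 ≤ slack n lam a b c :=
  mul_nonneg (by positivity) (add_nonneg (sub_mul_potential_nonneg hlam ha hb)
    (mul_nonneg (by positivity) (add_nonneg (potential_pred_sub_nonneg hlam ha)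
      (potential_pred_sub_nonneg hlam hb))))

theorem slack_ge {n : ℕ} {lam ε : ℝ} (hlam : 0 < lam) (hε : 0 < ε)
    (hgap : ∀ a < n, ε ≤ potential n lam a - potential n lam (a + 1)) {a b c : ℕ} (ha : a ≤ n)
    (hb : b ≤ n) (hca : c ≤ a) (h : a ≠ b ∨ 1 ≤ c) : lam / 2 * ε ≤ slack n lam a b c := by
  refine mul_le_mul_of_nonneg_left ?_ (by positivity)
  have h1 := sub_mul_potential_nonneg hlam ha hb
  have h2 := potential_pred_sub_nonneg hlam ha
  have h3 := potential_pred_sub_nonneg hlam hb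
  have hlt : ∀ a b, a < b → b ≤ n → ε ≤ (b - a) * (potential n lam a - potential n lam b) := by
    intro a b hab hb
    have e1 := hgap a (by omega)
    have e2 := potential_le hlam (show a + 1 ≤ b from hab) hb
    have e3 : (1 : ℝ) ≤ b - a := by
      have : (a : ℝ) + 1 ≤ b := by exact_mod_cast hab
      linarith
    nlinarith
  rcases h with h | h
  · have h4 := mul_nonneg (Nat.cast_nonneg c : (0 : ℝ) ≤ c) (add_nonneg h2 h3)
    rcases Nat.lt_or_gt_of_ne h with h | h
    · have := hlt a b h hb
      linarith
    · have := hlt b a h ha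
      linarith
  · have h4 : ε ≤ potential n lam (a - 1) - potential n lam a := by
      have := hgap (a - 1) (by omega)
      rwa [Nat.sub_add_cancel (by omega)] at this
    have h5 : (1 : ℝ) ≤ c := by exact_mod_cast h
    nlinarith

theorem slack_self (n : ℕ) (lam : ℝ) (a : ℕ) : slack n lam a a 0 = 0 := by simp [slack]

theorem matchGap_summand_nonneg {G : SimpleGraph V} {n : ℕ} (hG : ∀ v, (nb G v).card = n + 1)
    {lam : ℝ} (hlam : 0 < lam) {u v : V} (huv : G.Adj u v) (M : Finset (Sym2 V)) :
    0 ≤ lam ^ M.card *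
      slack n lam (freeCount G M u v) (freeCount G M v u) (commonCount G M u v) := by
  have ha := freeCount_add_one_le G M huv
  have hb := freeCount_add_one_le G M huv.symm
  rw [hG] at ha hb
  exact mul_nonneg (by positivity) (slack_nonneg hlam (by omega) (by omega) _)

theorem matchGap_nonneg {G : SimpleGraph V} {n : ℕ} (hG : ∀ v, (nb G v).card = n + 1)
    {lam : ℝ} (hlam : 0 < lam) (u : V) : 0 ≤ matchGap G n lam u :=
  sum_nonneg fun _ hv => sum_nonneg fun M _ => matchGap_summand_nonneg hG hlam (mem_nb.1 hv) M

theorem sum_mem_edge {G : SimpleGraph V} {M : Finset (Sym2 V)} (hM : M ∈ matchings G) (x : V) :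
    ∑ e ∈ M, (if x ∈ e then 1 else 0) = if Uncov M x then 0 else 1 := by
  split_ifs with h
  · exact sum_eq_zero fun e he => if_neg (h e he)
  · unfold Uncov at h
    push Not at h
    obtain ⟨e, he, hx⟩ := h
    rw [sum_eq_single e, if_pos hx]
    · intro f hf hfe
      exact if_neg fun hxf => hfe ((mem_matchings.1 hM).2 f hf e he x hxf hx)
    · exact fun h => absurd he h

/-- `S` is one side of a bipartition, so each edge of the matching covers exactly one vertex of `S`.
-/
theorem card_uncov_add_card {G : SimpleGraph V} {M : Finset (Sym2 V)} (hM : M ∈ matchings G)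
    (S : Finset V) (hS : ∀ x y, G.Adj x y → (x ∈ S ↔ y ∉ S)) :
    (S.filter (Uncov M)).card + M.card = S.card := by
  have h1 : ∑ x ∈ S, ∑ e ∈ M, (if x ∈ e then 1 else 0) = M.card := by
    rw [sum_comm, card_eq_sum_ones]
    refine sum_congr rfl fun e he => ?_
    have hedge := (mem_matchings.1 hM).1 e he
    induction e using Sym2.ind with
    | _ a b =>
      have hab : G.Adj a b := hedge
      rw [← card_filter, card_eq_one]
      by_cases ha : a ∈ S
      · refine ⟨a, ?_⟩
        have hb := (hS a b hab).1 ha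
        ext x
        simp only [mem_filter, Sym2.mem_iff, mem_singleton]
        constructor
        · rintro ⟨hx, rfl | rfl⟩
          · rfl
          · exact absurd hx hb
        · rintro rfl
          exact ⟨ha, Or.inl rfl⟩
      · refine ⟨b, ?_⟩
        have hb : b ∈ S := by
          by_contra hb
          exact ha ((hS a b hab).2 hb)
        ext x
        simp only [mem_filter, Sym2.mem_iff, mem_singleton]
        constructor
        · rintro ⟨hx, rfl | rfl⟩
          · exact absurd hx ha
          · rfl
        · rintro rfl
          exact ⟨hb, Or.inr rfl⟩
  simp only [sum_mem_edge hM] at h1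
  have h2 := card_filter_add_card_filter_not (s := S) (Uncov M)
  rw [← h1, ← h2]
  congr 1
  rw [card_filter]
  exact sum_congr rfl fun x _ => by split_ifs <;> simp_all

/-- A matching leaves equally many vertices uncovered on the two sides, which are the neighbourhoods
of `u` and `v`. -/
theorem freeCount_Kdd {d : ℕ} {u v : Fin d ⊕ Fin d} (huv : (Kdd d).Adj u v)
    {M : Finset (Sym2 (Fin d ⊕ Fin d))} (hM : M ∈ avoidPair (Kdd d) u v) :
    freeCount (Kdd d) M u v = freeCount (Kdd d) M v u := by
  obtain ⟨hM, hv, hu⟩ := mem_avoidPair.1 hM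
  have key : ∀ x, (freeNb (Kdd d) M x ∅).card + M.card = d := by
    intro x
    have h := card_uncov_add_card hM (nb (Kdd d) x)
      (by rintro (a | a) (b | b) <;> rcases x with x | x <;> simp)
    rw [card_nb_Kdd] at h
    rw [← freeNb_empty_eq_filter] at h
    exact h
  have h1 := key u
  have h2 := key v
  rw [card_freeNb_empty huv hv] at h1
  rw [card_freeNb_empty huv.symm hu] at h2
  omega

theorem commonCount_of_isGood {G : SimpleGraph V} {u v : V} (hu : IsGood G u) (huv : G.Adj u v)
    (M : Finset (Sym2 V)) : commonCount G M u v = 0 := by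
  rw [commonCount, card_eq_zero]
  refine eq_empty_of_forall_notMem fun y hy => ?_
  have hy := mem_inter.1 hy
  exact hu.1 v y huv (mem_freeNb.1 hy.1).1 (mem_freeNb.1 hy.2).1

theorem mul_alphaMatch_of_matchGap_eq_zero [Nonempty V] {G : SimpleGraph V} {n : ℕ}
    (hG : ∀ v, (nb G v).card = n + 1) {lam : ℝ} (hlam : 0 < lam)
    (h0 : ∀ u, matchGap G n lam u = 0) :
    (1 + lam + lam * (n + chainMean n lam)) * alphaMatch G lam = lam := by
  have h := sum_matchGap hG hlam
  simp only [h0, sum_const_zero, mul_zero] at h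
  have hZ := (zMatch_pos G hlam.le).ne'
  have hn : (Fintype.card V : ℝ) ≠ 0 := by exact_mod_cast Fintype.card_ne_zero
  have := (mul_eq_zero.1 h.symm).resolve_left (by positivity)
  linarith

theorem alphaMatch_Kdd (n : ℕ) {lam : ℝ} (hlam : 0 < lam) :
    (1 + lam + lam * (n + chainMean n lam)) * alphaMatch (Kdd (n + 1)) lam = lam :=
  mul_alphaMatch_of_matchGap_eq_zero (card_nb_Kdd (n + 1)) hlam fun u =>
    sum_eq_zero fun v hv => sum_eq_zero fun M hM => by
      rw [freeCount_Kdd (mem_nb.1 hv) hM, commonCount_of_isGood (isGood_Kdd _ u) (mem_nb.1 hv),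
        slack_self, mul_zero]

/-! ### Quantitative gap for matchings at a bad vertex -/

/-- The probability that a random matching has prescribed edges meeting `S` is bounded below. -/
theorem zMatch_le_sum_touching_eq {G : SimpleGraph V} {d : ℕ} (hG : ∀ v, (nb G v).card = d)
    {lam : ℝ} (hlam : 0 ≤ lam) {S : Finset V} {T : Finset (Sym2 V)} (hT : T ∈ matchings G)
    (hTS : ∀ e ∈ T, ∀ x ∈ e, x ∈ S) :
    lam ^ T.card * zMatch G lam ≤ (1 + lam) ^ (S.card * d) *
      ∑ M ∈ (matchings G).filter (fun M => touching M S = T), lam ^ M.card := by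
  set E : Finset (Sym2 V) := S.biUnion fun x => (nb G x).image fun y => s(x, y) with hE
  have hEc : E.card ≤ S.card * d :=
    card_biUnion_le_card_mul _ _ _ fun x _ => card_image_le.trans (hG x).le
  have hsub : ∀ M ∈ matchings G, touching M S ⊆ E := by
    intro M hM e he
    obtain ⟨he, x, hx, hxe⟩ := mem_filter.1 he
    obtain ⟨y, rfl⟩ := Sym2.mem_iff_exists.1 hxe
    exact mem_biUnion.2 ⟨x, hx, mem_image.2 ⟨y, mem_nb.2 ((mem_matchings.1 hM).1 _ he), rfl⟩⟩
  have hsplit : ∀ M : Finset (Sym2 V), M \ touching M S ∪ touching M S = M := fun M =>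
    sdiff_union_of_subset (filter_subset _ _)
  have hfar : ∀ M : Finset (Sym2 V), touching (M \ touching M S) S = ∅ := fun M => by
    refine eq_empty_of_forall_notMem fun e he => ?_
    obtain ⟨he, h⟩ := mem_filter.1 he
    exact (mem_sdiff.1 he).2 (mem_filter.2 ⟨(mem_sdiff.1 he).1, h⟩)
  have h1 : zMatch G lam ≤ ∑ p ∈ ((matchings G).filter fun M => touching M S = ∅) ×ˢ E.powerset,
      lam ^ p.1.card * lam ^ p.2.card := by
    refine sum_le_sum_of_injOn (fun M => (M \ touching M S, touching M S)) ?_ ?_ ?_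
      fun _ _ => by positivity
    · intro M hM
      exact mem_product.2 ⟨mem_filter.2 ⟨matchings_mono hM sdiff_subset, hfar M⟩,
        mem_powerset.2 (hsub M hM)⟩
    · intro M _ M' _ h
      rw [Prod.mk.injEq] at h
      rw [← hsplit M, h.1, h.2, hsplit M']
    · intro M _
      rw [← pow_add]
      exact (congrArg _ (card_sdiff_add_card_eq_card (filter_subset _ _)).symm).le
  rw [sum_product] at h1
  simp only at h1
  rw [← sum_mul_sum, sum_powerset_pow_card] at h1
  have hTt : ∀ K ∈ (matchings G).filter (fun M => touching M S = ∅), ∀ e ∈ K, ∀ x ∈ S, x ∉ e := by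
    intro K hK e he x hx hxe
    have : e ∈ touching K S := mem_filter.2 ⟨he, x, hx, hxe⟩
    rw [(mem_filter.1 hK).2] at this
    simp at this
  have hTne : ∀ e ∈ T, ∃ x ∈ S, x ∈ e := fun e he => by
    induction e using Sym2.ind with
    | _ a b => exact ⟨a, hTS _ he a (by simp), by simp⟩
  have hdis : ∀ K ∈ (matchings G).filter (fun M => touching M S = ∅), Disjoint T K :=
    fun K hK => disjoint_left.2 fun e heT heK => by
      obtain ⟨x, hx, hxe⟩ := hTne e heT
      exact hTt K hK e heK x hx hxe
  have h2 : lam ^ T.card * ∑ K ∈ (matchings G).filter (fun M => touching M S = ∅), lam ^ K.card ≤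
      ∑ M ∈ (matchings G).filter (fun M => touching M S = T), lam ^ M.card := by
    rw [mul_sum]
    refine sum_le_sum_of_injOn (fun K => T ∪ K) ?_ ?_ ?_ fun _ _ => by positivity
    · intro K hK
      have hKm := (mem_filter.1 hK).1
      refine mem_filter.2 ⟨mem_matchings.2 ⟨fun e he => ?_, fun e he f hf x hxe hxf => ?_⟩, ?_⟩
      · rcases mem_union.1 he with he | he
        · exact (mem_matchings.1 hT).1 e he
        · exact (mem_matchings.1 hKm).1 e he
      · rcases mem_union.1 he with he | he <;> rcases mem_union.1 hf with hf | hf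
        · exact (mem_matchings.1 hT).2 e he f hf x hxe hxf
        · exact absurd hxf (hTt K hK f hf x (hTS e he x hxe))
        · exact absurd hxe (hTt K hK e he x (hTS f hf x hxf))
        · exact (mem_matchings.1 hKm).2 e he f hf x hxe hxf
      · ext e
        simp only [touching, mem_filter, mem_union]
        constructor
        · rintro ⟨he | he, x, hx, hxe⟩
          · exact he
          · exact absurd hxe (hTt K hK e he x hx)
        · exact fun he => ⟨Or.inl he, hTne e he⟩
    · intro K hK K' hK' h
      rw [← union_sdiff_cancel_left (hdis K hK), ← union_sdiff_cancel_left (hdis K' hK')]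
      exact congrArg (· \ T) h
    · intro K hK
      rw [card_union_of_disjoint (hdis K hK), pow_add]
  have hs : (1 : ℝ) ≤ 1 + lam := by linarith
  set R := ∑ K ∈ (matchings G).filter (fun M => touching M S = ∅), lam ^ K.card
  have hR : 0 ≤ R := sum_nonneg fun _ _ => by positivity
  calc lam ^ T.card * zMatch G lam ≤ lam ^ T.card * (R * (1 + lam) ^ E.card) :=
        mul_le_mul_of_nonneg_left h1 (by positivity)
    _ ≤ lam ^ T.card * (R * (1 + lam) ^ (S.card * d)) := by
        gcongr
    _ = (1 + lam) ^ (S.card * d) * (lam ^ T.card * R) := by ring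
    _ ≤ _ := mul_le_mul_of_nonneg_left h2 (by positivity)

/-- Near a vertex that is not good there is a dart with a local configuration of positive slack. -/
theorem exists_dart_of_not_isGood {G : SimpleGraph V} {d : ℕ} (hG : ∀ v, (nb G v).card = d)
    {v : V} (hv : ¬ IsGood G v) :
    ∃ u, G.Adj v u ∧ ∃ (T : Finset (Sym2 V)) (S : Finset V), T ∈ matchings G ∧ T.card ≤ 1 ∧
      (∀ e ∈ T, ∀ x ∈ e, x ∈ S) ∧ S.card ≤ 2 * d + 2 ∧
      ∀ M ∈ matchings G, touching M S = T → M ∈ avoidPair G v u ∧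
        (freeCount G M v u ≠ freeCount G M u v ∨ 1 ≤ commonCount G M v u) := by
  have hSc : ∀ u w, (insert w (insert v (nb G v ∪ nb G u))).card ≤ 2 * d + 2 := fun u w => by
    have h1 := card_insert_le w (insert v (nb G v ∪ nb G u))
    have h2 := card_insert_le v (nb G v ∪ nb G u)
    have h3 := card_union_le (nb G v) (nb G u)
    rw [hG, hG] at h3
    omega
  by_cases h : ∃ u u', G.Adj v u ∧ G.Adj v u' ∧ G.Adj u u'
  · obtain ⟨u, u', hu, hu', huu'⟩ := h
    -- With no edge of `M` touching the closed neighbourhoods, `u'` is a free common neighbour. The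
    -- repeated `v` only lets `hSc` apply.
    refine ⟨u, hu, ∅, insert v (insert v (nb G v ∪ nb G u)), mem_matchings.2 (by simp), by simp,
      by simp, hSc u v, fun M hM hMT => ?_⟩
    have hun : ∀ x ∈ insert v (insert v (nb G v ∪ nb G u)), Uncov M x := fun x hx =>
      uncov_of_touching hx (by rw [hMT]; simp [Uncov])
    refine ⟨mem_avoidPair.2 ⟨hM, hun u (by simp [hu]), hun v (by simp)⟩, Or.inr ?_⟩
    refine card_pos.2 ⟨u', mem_inter.2 ⟨mem_freeNb.2 ⟨hu', ?_, hun u' (by simp [hu'])⟩,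
      mem_freeNb.2 ⟨huu', ?_, hun u' (by simp [hu'])⟩⟩⟩
    · simpa using huu'.ne'
    · simpa using hu'.ne'
  · have h1 : ∀ u u', G.Adj v u → G.Adj v u' → ¬ G.Adj u u' := fun u u' a b c =>
      h ⟨u, u', a, b, c⟩
    have h2 : ¬ ∀ u u' w, G.Adj v u → G.Adj v u' → G.Adj u w → G.Adj u' w :=
      fun h2 => hv ⟨h1, h2⟩
    push Not at h2
    obtain ⟨u, u', w, hu, hu', huw, hu'w⟩ := h2
    have huu' : u ≠ u' := by rintro rfl; exact hu'w huw
    have hwv : w ≠ v := by rintro rfl; exact hu'w hu'.symm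
    have hvw : ¬ G.Adj v w := fun h => h1 u w hu h huw
    have hwu' : w ≠ u' := by rintro rfl; exact hvw hu'
    -- Prescribing the edge `uw` uses up a neighbour of `v` and none of `u'`: the free counts are at
    -- most `d - 2` for `v` and exactly `d - 1` for `u'`.
    refine ⟨u', hu', {s(u, w)}, insert w (insert v (nb G v ∪ nb G u')), ?_, by simp, ?_,
      hSc u' w, fun M hM hMT => ?_⟩
    · refine mem_matchings.2 ⟨by simpa using huw, ?_⟩
      intro e he f hf _ _ _
      rw [mem_singleton.1 he, mem_singleton.1 hf]
    · simp [hu]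
    · have hun : ∀ x ∈ insert w (insert v (nb G v ∪ nb G u')), x ≠ u → x ≠ w → Uncov M x :=
        fun x hx hxu hxw => uncov_of_touching hx (by
          rw [hMT]
          simp [Uncov, hxu, hxw])
      have hvu := hun v (by simp) hu.ne hwv.symm
      refine ⟨mem_avoidPair.2 ⟨hM, hun u' (by simp [hu']) huu'.symm hwu'.symm, hvu⟩, Or.inl ?_⟩
      have hb : freeNb G M u' {v} = (nb G u').erase v := by
        ext x
        simp only [mem_freeNb, mem_singleton, mem_erase, mem_nb]
        constructor
        · rintro ⟨a, b, _⟩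
          exact ⟨b, a⟩
        · rintro ⟨a, b⟩
          refine ⟨b, a, hun x (by simp [b]) ?_ ?_⟩
          · rintro rfl; exact h1 u' x hu' hu b
          · rintro rfl; exact hu'w b
      have ha : freeNb G M v {u'} ⊆ ((nb G v).erase u').erase u := by
        intro x hx
        rw [mem_freeNb, mem_singleton] at hx
        refine mem_erase.2 ⟨?_, mem_erase.2 ⟨hx.2.1, mem_nb.2 hx.1⟩⟩
        rintro rfl
        have : s(x, w) ∈ touching M (insert w (insert v (nb G v ∪ nb G u'))) := by
          rw [hMT]; simp
        exact hx.2.2 _ (mem_filter.1 this).1 (by simp)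
      have c1 := card_le_card ha
      have c2 := card_erase_add_one (show u ∈ (nb G v).erase u' by simp [huu', hu])
      have c3 := card_erase_add_one (show u' ∈ nb G v by simp [hu'])
      have c4 := card_erase_add_one (show v ∈ nb G u' by simp [hu'.symm])
      rw [hG] at c3 c4
      rw [freeCount, freeCount, hb]
      omega

/-- One dart and one prescribed edge pattern already give slack `lam / 2 * ε` on all matchings with
that pattern. The remaining factor is the price of the pattern: `S` meets at most `(2d + 2)d` edges,
where `d = n + 1`, and at most one is prescribed. -/
theorem matchGap_ge_of_not_isGood {G : SimpleGraph V} {n : ℕ} (hG : ∀ v, (nb G v).card = n + 1)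
    {lam ε : ℝ} (hlam : 0 < lam) (hε : 0 < ε)
    (hgap : ∀ a < n, ε ≤ potential n lam a - potential n lam (a + 1)) {v : V}
    (hv : ¬ IsGood G v) :
    lam / 2 * ε * (lam / (1 + lam) / (1 + lam) ^ ((2 * (n + 1) + 2) * (n + 1))) * zMatch G lam ≤
      matchGap G n lam v := by
  obtain ⟨u, hvu, T, S, hT, hT1, hTS, hS, hM⟩ := exists_dart_of_not_isGood hG hv
  have hp := zMatch_le_sum_touching_eq hG hlam.le hT hTS
  set R := ∑ M ∈ (matchings G).filter (fun M => touching M S = T), lam ^ M.card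
  have hR : 0 ≤ R := sum_nonneg fun _ _ => by positivity
  have h1 : lam / 2 * ε * R ≤ matchGap G n lam v := by
    have h2 : ∑ M ∈ avoidPair G v u, lam ^ M.card *
        slack n lam (freeCount G M v u) (freeCount G M u v) (commonCount G M v u) ≤
        matchGap G n lam v :=
      single_le_sum (f := fun u => ∑ M ∈ avoidPair G v u, lam ^ M.card *
        slack n lam (freeCount G M v u) (freeCount G M u v) (commonCount G M v u))
        (fun w hw => sum_nonneg fun M _ => matchGap_summand_nonneg hG hlam (mem_nb.1 hw) M)
        (mem_nb.2 hvu)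
    refine le_trans ?_ h2
    rw [mul_sum]
    refine sum_le_sum_of_injOn id (fun M h => (hM M (mem_filter.1 h).1 (mem_filter.1 h).2).1)
      (Set.injOn_id _) ?_ fun M _ => matchGap_summand_nonneg hG hlam hvu M
    intro M h
    have ha := freeCount_add_one_le G M hvu
    have hb := freeCount_add_one_le G M hvu.symm
    rw [hG] at ha hb
    rw [mul_comm, id]
    exact mul_le_mul_of_nonneg_left (slack_ge hlam hε hgap (by omega) (by omega)
      (commonCount_le G M v u) (hM M (mem_filter.1 h).1 (mem_filter.1 h).2).2) (by positivity)
  refine le_trans ?_ h1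
  rw [mul_assoc]
  refine mul_le_mul_of_nonneg_left ?_ (by positivity)
  have hTl : lam / (1 + lam) ≤ lam ^ T.card := by
    rw [div_le_iff₀ (by positivity)]
    interval_cases T.card
    · simp
    · nlinarith
  have hZ := zMatch_pos G hlam.le
  have hSp : (1 + lam) ^ (S.card * (n + 1)) ≤ (1 + lam) ^ ((2 * (n + 1) + 2) * (n + 1)) :=
    pow_le_pow_right₀ (by linarith) (Nat.mul_le_mul_right _ hS)
  rw [div_mul_eq_mul_div, div_le_iff₀ (by positivity), mul_comm R]
  exact ((mul_le_mul_of_nonneg_right hTl hZ.le).trans hp).trans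
    (mul_le_mul_of_nonneg_right hSp hR)

theorem chainMean_nonneg (n : ℕ) {lam : ℝ} (hlam : 0 < lam) : 0 ≤ chainMean n lam := by
  rcases Nat.eq_zero_or_pos n with rfl | h
  · simp [chainMean]
  · exact (chainMean_pos h hlam).le

/-- Stability for the monomer-dimer model in terms of the fraction of vertices that are not
good. -/
theorem alphaMatch_le [Nonempty V] {G : SimpleGraph V} {n : ℕ}
    (hG : ∀ v, (nb G v).card = n + 1) {lam ε : ℝ} (hlam : 0 < lam) (hε : 0 < ε)
    (hgap : ∀ a < n, ε ≤ potential n lam a - potential n lam (a + 1)) :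
    alphaMatch G lam ≤ alphaMatch (Kdd (n + 1)) lam -
      lam * (lam / 2 * ε * (lam / (1 + lam) / (1 + lam) ^ ((2 * (n + 1) + 2) * (n + 1)))) /
        ((n + 1) * (1 + lam + lam * (n + chainMean n lam))) *
        (badCount G / Fintype.card V) := by
  have h1 := sum_matchGap hG hlam
  have h2 := alphaMatch_Kdd n hlam
  set κ := lam / 2 * ε * (lam / (1 + lam) / (1 + lam) ^ ((2 * (n + 1) + 2) * (n + 1)))
  have h3 : badCount G * (κ * zMatch G lam) ≤ ∑ v, matchGap G n lam v := by
    rw [badCount, ← nsmul_eq_mul, ← sum_const]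
    exact (sum_le_sum fun v hv =>
        matchGap_ge_of_not_isGood hG hlam hε hgap (mem_filter.1 hv).2).trans
      (sum_le_sum_of_subset_of_nonneg (subset_univ _) fun v _ _ => matchGap_nonneg hG hlam v)
  have hZ := zMatch_pos G hlam.le
  have hm := chainMean_nonneg n hlam
  have hn : (0 : ℝ) < Fintype.card V := by exact_mod_cast Fintype.card_pos
  have hE : 0 < 1 + lam + lam * (n + chainMean n lam) := by positivity
  set W := 1 + lam + lam * (n + chainMean n lam)
  have h3 := mul_le_mul_of_nonneg_left h3 hlam.le
  rw [h1] at h3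
  have h4 : lam * (badCount G * κ) ≤ (n + 1) * Fintype.card V *
      (W * alphaMatch (Kdd (n + 1)) lam - W * alphaMatch G lam) := by
    rw [h2]
    refine le_of_mul_le_mul_right ?_ hZ
    linarith
  rw [le_sub_comm, div_mul_div_comm, div_le_iff₀ (by positivity)]
  linarith

end Matchings

end OccStability

/-! ### Sampling distance and the fraction of bad vertices -/

namespace OccStability

open scoped Classical

section SamplingBound

open Finset

theorem rootedClass_eq {W W' : Type*} [Fintype W] [Fintype W'] {H : SimpleGraph W}
    {H' : SimpleGraph W'} {w : W} {w' : W'} (ψ : H ≃g H') (h : ψ w = w') :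
    rootedClass H w = rootedClass H' w' := by
  refine Quotient.sound ⟨(SimpleGraph.Iso.comap (Fintype.equivFin W).symm H).trans
    (ψ.trans (SimpleGraph.Iso.comap (Fintype.equivFin W').symm H').symm), ?_⟩
  simp [SimpleGraph.Iso.comap, ← h]

/-- The range is closed under adjacency, so a walk starting in it never leaves. -/
theorem exists_walk_lift {W V : Type*} {H : SimpleGraph W} {G : SimpleGraph V} (φ : H ↪g G)
    (hcl : ∀ x z, G.Adj (φ x) z → z ∈ Set.range φ) {a b : V} (p : G.Walk a b) :
    ∀ x, φ x = a → ∃ y, φ y = b ∧ ∃ q : H.Walk x y, q.length = p.length := by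
  induction p with
  | nil => exact fun x hx => ⟨x, hx, SimpleGraph.Walk.nil, rfl⟩
  | cons h p ih =>
    rintro x rfl
    obtain ⟨z, rfl⟩ := hcl x _ h
    obtain ⟨y, hy, q, hq⟩ := ih z rfl
    exact ⟨y, hy, SimpleGraph.Walk.cons (φ.map_adj_iff.1 h) q, by simp [hq]⟩

/-- An embedding onto a union of components preserves distances. -/
theorem edist_embedding {W V : Type*} {H : SimpleGraph W} {G : SimpleGraph V} (φ : H ↪g G)
    (hcl : ∀ x z, G.Adj (φ x) z → z ∈ Set.range φ) (x y : W) :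
    G.edist (φ x) (φ y) = H.edist x y := by
  refine le_antisymm (le_iInf fun q => ?_) (le_iInf fun p => ?_)
  · exact (SimpleGraph.Walk.edist_le (q.map φ.toHom)).trans (by simp)
  · obtain ⟨y', hy', q, hq⟩ := exists_walk_lift φ hcl p x rfl
    obtain rfl := φ.injective hy'
    rw [← hq]
    exact SimpleGraph.Walk.edist_le q

theorem ballClass_embedding {W V : Type*} [Fintype W] [Fintype V] {H : SimpleGraph W}
    {G : SimpleGraph V} (φ : H ↪g G) (hcl : ∀ x z, G.Adj (φ x) z → z ∈ Set.range φ) (r : ℕ)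
    (x : W) : ballClass G r (φ x) = ballClass H r x := by
  have hmem : ∀ y, y ∈ ballSet H r x ↔ φ y ∈ ballSet G r (φ x) := fun y => by
    simp only [ballSet, Set.mem_ofPred_eq, edist_embedding φ hcl]
  have hrange : ∀ z ∈ ballSet G r (φ x), z ∈ Set.range φ := fun z hz => by
    have hne : G.edist (φ x) z ≠ ⊤ := ne_top_of_le_ne_top (ENat.natCast_ne_top r) hz
    obtain ⟨p⟩ := SimpleGraph.reachable_of_edist_ne_top hne
    obtain ⟨y, hy, _⟩ := exists_walk_lift φ hcl p x rfl
    exact ⟨y, hy⟩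
  let f : ballSet H r x → ballSet G r (φ x) := fun y => ⟨φ y, (hmem y).1 y.2⟩
  have hf : Function.Bijective f := by
    constructor
    · intro y y' h
      exact Subtype.ext (φ.injective (congrArg Subtype.val h))
    · rintro ⟨z, hz⟩
      obtain ⟨y, rfl⟩ := hrange z hz
      exact ⟨⟨y, (hmem y).2 hz⟩, rfl⟩
  let ψ : H.induce (ballSet H r x) ≃g G.induce (ballSet G r (φ x)) :=
    ⟨Equiv.ofBijective f hf, fun {a b} => by simp [f]⟩
  symm
  refine rootedClass_eq ψ ?_
  rfl

variable {V : Type*} [Fintype V]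

theorem exists_equiv_nb {G : SimpleGraph V} {d : ℕ} (hd : 1 ≤ d) {u v : V}
    (hu : (nb G u).card = d) (huv : G.Adj u v) :
    ∃ e : Fin d → V, Function.Injective e ∧ e ⟨0, hd⟩ = v ∧ ∀ x, G.Adj u x ↔ x ∈ Set.range e := by
  let e₀ : Fin d ≃ nb G u := (finCongr hu.symm).trans (nb G u).equivFin.symm
  -- The swap normalises the enumeration so that index `0` is sent to `v`, which later fixes the
  -- image of the root.
  let e := (Equiv.swap ⟨0, hd⟩ (e₀.symm ⟨v, mem_nb.2 huv⟩)).trans e₀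
  refine ⟨fun i => e i, fun i j h => e.injective (Subtype.ext h), by simp [e], fun x => ?_⟩
  constructor
  · intro h
    exact ⟨e.symm ⟨x, mem_nb.2 h⟩, by simp⟩
  · rintro ⟨i, rfl⟩
    exact mem_nb.1 (e i).2

/-- In a regular graph the component of a good vertex is a copy of `K_{d,d}`. -/
theorem exists_embedding_of_isGood {G : SimpleGraph V} {d : ℕ} (hd : 1 ≤ d)
    (hG : ∀ v, (nb G v).card = d) {v : V} (hv : IsGood G v) :
    ∃ φ : Kdd d ↪g G, φ (Sum.inl ⟨0, hd⟩) = v ∧ ∀ x z, G.Adj (φ x) z → z ∈ Set.range φ := by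
  obtain ⟨u, hu⟩ : (nb G v).Nonempty := card_pos.1 (by rw [hG]; omega)
  rw [mem_nb] at hu
  obtain ⟨e, he, he0, hemem⟩ := exists_equiv_nb hd (hG u) hu.symm
  obtain ⟨f, hf, _, hfmem⟩ := exists_equiv_nb hd (hG v) hu
  have hue : ∀ i, G.Adj u (e i) := fun i => (hemem _).2 ⟨i, rfl⟩
  have hvf : ∀ j, G.Adj v (f j) := fun j => (hfmem _).2 ⟨j, rfl⟩
  have hef : ∀ i j, G.Adj (e i) (f j) := fun i j => (hv.2 u (f j) (e i) hu (hvf j) (hue i)).symm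
  -- `N(v)` is contained in `N(e i)`, and both have `d` elements, so they coincide. This is where
  -- regularity closes up the component.
  have hnbe : ∀ i z, G.Adj (e i) z → G.Adj v z := by
    intro i z hz
    have hsub : nb G v ⊆ nb G (e i) := fun y hy => by
      obtain ⟨j, rfl⟩ := (hfmem y).1 (mem_nb.1 hy)
      exact mem_nb.2 (hef i j)
    have := eq_of_subset_of_card_le hsub (by rw [hG, hG])
    exact mem_nb.1 (this ▸ mem_nb.2 hz)
  have hee : ∀ i i', ¬ G.Adj (e i) (e i') := fun i i' h =>
    hv.1 u (e i') hu (hnbe i _ h) (hue i')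
  have hff : ∀ j j', ¬ G.Adj (f j) (f j') := fun j j' => hv.1 _ _ (hvf j) (hvf j')
  have hne : ∀ i j, e i ≠ f j := fun i j h => hff j j (h ▸ hef i j)
  refine ⟨⟨⟨Sum.elim e f, he.sumElim hf hne⟩, ?_⟩, he0, ?_⟩
  · rintro (i | i) (j | j)
    · simpa using hee i j
    · simpa using hef i j
    · simpa using (hef j i).symm
    · simpa using hff i j
  · rintro (i | j) z hz
    · obtain ⟨j, rfl⟩ := (hfmem z).1 (hnbe i z hz)
      exact ⟨Sum.inr j, rfl⟩
    · obtain ⟨i, rfl⟩ := (hemem z).1 (hv.2 (f j) u z (hvf j) hu hz)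
      exact ⟨Sum.inl i, rfl⟩

theorem ballClass_of_isGood {G : SimpleGraph V} {d : ℕ} (hd : 1 ≤ d)
    (hG : ∀ v, (nb G v).card = d) {v : V} (hv : IsGood G v) (r : ℕ) :
    ballClass G r v = ballClass (Kdd d) r (Sum.inl ⟨0, hd⟩) := by
  obtain ⟨φ, hφ, hcl⟩ := exists_embedding_of_isGood hd hG hv
  rw [← hφ, ballClass_embedding φ hcl]

theorem rho_Kdd {d : ℕ} (hd : 1 ≤ d) (r : ℕ) (c : RootedClass) :
    rho r (Kdd d) c = if c = ballClass (Kdd d) r (Sum.inl ⟨0, hd⟩) then 1 else 0 := by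
  have h : ∀ v, ballClass (Kdd d) r v = ballClass (Kdd d) r (Sum.inl ⟨0, hd⟩) := fun v =>
    ballClass_of_isGood hd (card_nb_Kdd d) (isGood_Kdd d v) r
  have hn : ((Fintype.card (Fin d ⊕ Fin d) : ℕ) : ℝ) ≠ 0 := by
    simp only [Fintype.card_sum, Fintype.card_fin]
    positivity
  unfold rho
  split_ifs with hc
  · rw [filter_true_of_mem fun v _ => (h v).trans hc.symm, card_univ, div_self hn]
  · rw [filter_false_of_mem fun v _ hv => hc (hv.symm.trans (h v))]
    simp

/-- The distribution for `K_{d,d}` is a point mass at `c₀`, so the total variation distance is the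
mass the other distribution puts off `c₀`; only bad vertices can contribute to it. -/
theorem tvDist_rho_le [Nonempty V] {G : SimpleGraph V} {d : ℕ} (hd : 1 ≤ d)
    (hG : ∀ v, (nb G v).card = d) (r : ℕ) :
    tvDist (rho r G) (rho r (Kdd d)) ≤ badCount G / Fintype.card V := by
  set c₀ := ballClass (Kdd d) r (Sum.inl ⟨0, hd⟩) with hc₀
  set s : Finset RootedClass := univ.image (ballClass G r) with hs
  have hn : (0 : ℝ) < Fintype.card V := by exact_mod_cast Fintype.card_pos
  have hnn : ∀ c, 0 ≤ rho r G c := fun c => by unfold rho; positivity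
  have hzero : ∀ c ∉ s, rho r G c = 0 := fun c hc => by
    unfold rho
    rw [filter_false_of_mem fun v _ hv => hc (mem_image.2 ⟨v, mem_univ v, hv⟩)]
    simp
  have hsum : ∑ c ∈ insert c₀ s, rho r G c = 1 := by
    unfold rho
    rw [← sum_div, div_eq_one_iff_eq hn.ne', ← Nat.cast_sum, ← card_univ,
      card_eq_sum_card_fiberwise (f := ballClass G r) (t := insert c₀ s)
        fun v _ => mem_insert_of_mem (mem_image_of_mem _ (mem_univ v))]
  have hc : 1 - badCount G / Fintype.card V ≤ rho r G c₀ := by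
    unfold rho
    rw [one_sub_div hn.ne', div_le_div_iff_of_pos_right hn, sub_le_iff_le_add]
    have h1 : Fintype.card V = (univ.filter fun v => IsGood G v).card + badCount G := by
      rw [badCount, card_filter_add_card_filter_not, card_univ]
    have h2 : (univ.filter fun v => IsGood G v).card ≤
        (univ.filter fun v => ballClass G r v = c₀).card :=
      card_le_card fun v hv => mem_filter.2 ⟨mem_univ v,
        ballClass_of_isGood hd hG (mem_filter.1 hv).2 r⟩
    exact_mod_cast h1.le.trans (Nat.add_le_add_right h2 _)
  have hle : rho r G c₀ ≤ 1 := by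
    rw [← hsum]
    exact single_le_sum (fun c _ => hnn c) (mem_insert_self _ _)
  have htv : ∑' c, |rho r G c - rho r (Kdd d) c| = 2 * (1 - rho r G c₀) := by
    rw [tsum_eq_sum (s := insert c₀ s) fun c hc => by
      rw [mem_insert, not_or] at hc
      rw [hzero c hc.2, rho_Kdd hd, if_neg hc.1, sub_zero, abs_zero]]
    have hpt : ∀ c ∈ insert c₀ s, |rho r G c - rho r (Kdd d) c| =
        rho r G c + if c = c₀ then 1 - 2 * rho r G c₀ else 0 := fun c _ => by
      rw [rho_Kdd hd]
      split_ifs with h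
      · rw [h, abs_sub_comm, abs_of_nonneg (by linarith)]
        ring
      · rw [sub_zero, abs_of_nonneg (hnn c), add_zero]
    rw [sum_congr rfl hpt, sum_add_distrib, hsum, sum_ite_eq', if_pos (mem_insert_self _ _)]
    ring
  rw [tvDist, htv]
  linarith

/-- The sampling distance to `K_{d,d}` is at most the fraction of vertices that are not good. -/
theorem samplingDist_le [Nonempty V] {G : SimpleGraph V} {d : ℕ} (hd : 1 ≤ d)
    (hG : ∀ v, (nb G v).card = d) :
    samplingDist G (Kdd d) ≤ badCount G / Fintype.card V := by
  have hgeo : HasSum (fun k : ℕ => (1 / 2 : ℝ) ^ (k + 1) * (badCount G / Fintype.card V))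
      (badCount G / Fintype.card V) := by
    have h := (hasSum_geometric_two.mul_left (1 / 2 : ℝ)).mul_right
      ((badCount G : ℝ) / Fintype.card V)
    simpa [pow_succ'] using h
  have hle : ∀ k : ℕ, (1 / 2 : ℝ) ^ (k + 1) * tvDist (rho (k + 1) G) (rho (k + 1) (Kdd d)) ≤
      (1 / 2 : ℝ) ^ (k + 1) * (badCount G / Fintype.card V) := fun k =>
    mul_le_mul_of_nonneg_left (tvDist_rho_le hd hG (k + 1)) (by positivity)
  have hnn : ∀ k : ℕ, 0 ≤ (1 / 2 : ℝ) ^ (k + 1) *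
      tvDist (rho (k + 1) G) (rho (k + 1) (Kdd d)) := fun k =>
    mul_nonneg (by positivity) (mul_nonneg (by norm_num) (tsum_nonneg fun _ => abs_nonneg _))
  rw [← hgeo.tsum_eq]
  exact (Summable.of_nonneg_of_le hnn hle hgeo.summable).tsum_le_tsum hle hgeo.summable

theorem samplingDist_nonneg {V' : Type*} [Fintype V'] (G : SimpleGraph V) (G' : SimpleGraph V') :
    0 ≤ samplingDist G G' :=
  tsum_nonneg fun _ => mul_nonneg (by positivity)
    (mul_nonneg (by norm_num) (tsum_nonneg fun _ => abs_nonneg _))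

end SamplingBound

/-! ### Positive continuous constants on the closed half-line -/

section Constants

/-- A rate that is positive and continuous on `(0, ∞)`, cut off so as to extend by zero. -/
noncomputable def cutoff (e : ℝ → ℝ) (x : ℝ) : ℝ := if x ≤ 0 then 0 else min (e x) x

theorem cutoff_pos {e : ℝ → ℝ} (he : ∀ x, 0 < x → 0 < e x) {x : ℝ} (hx : 0 < x) :
    0 < cutoff e x := by
  rw [cutoff, if_neg hx.not_ge]
  exact lt_min (he x hx) hx

theorem cutoff_nonneg {e : ℝ → ℝ} (he : ∀ x, 0 < x → 0 < e x) (x : ℝ) : 0 ≤ cutoff e x := by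
  rcases le_or_gt x 0 with h | h
  · rw [cutoff, if_pos h]
  · exact (cutoff_pos he h).le

theorem cutoff_le {e : ℝ → ℝ} {x : ℝ} (hx : 0 < x) : cutoff e x ≤ e x := by
  rw [cutoff, if_neg hx.not_ge]
  exact min_le_left _ _

theorem continuousOn_cutoff {e : ℝ → ℝ} (he : ∀ x, 0 < x → 0 < e x)
    (hc : ContinuousOn e (Set.Ioi 0)) : ContinuousOn (cutoff e) (Set.Ici 0) := by
  intro x hx
  rcases (Set.mem_Ici.1 hx).eq_or_lt with rfl | hx
  · have h0 : cutoff e 0 = 0 := by simp [cutoff]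
    have hid : Filter.Tendsto (fun x : ℝ => x) (nhdsWithin 0 (Set.Ici 0)) (nhds 0) :=
      Filter.tendsto_id.mono_left nhdsWithin_le_nhds
    rw [ContinuousWithinAt, h0]
    -- No information on `e` near zero is needed: the minimum with `x` squeezes the cutoff between
    -- `0` and `x`.
    refine tendsto_of_tendsto_of_tendsto_of_le_of_le' tendsto_const_nhds hid
      (Filter.Eventually.of_forall (cutoff_nonneg he)) ?_
    filter_upwards [self_mem_nhdsWithin] with x hx
    rcases (Set.mem_Ici.1 hx).eq_or_lt with rfl | hx
    · exact h0.le
    · rw [cutoff, if_neg hx.not_ge]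
      exact min_le_right _ _
  · have h1 : ContinuousAt (fun y => min (e y) y) x :=
      (hc.continuousAt (Ioi_mem_nhds hx)).min continuousAt_id
    refine (h1.congr ?_).continuousWithinAt
    filter_upwards [Ioi_mem_nhds hx] with y hy
    rw [cutoff, if_neg (not_le.2 hy)]

theorem le_sub_cutoff_mul {e : ℝ → ℝ} {x α β δ p : ℝ} (hx : 0 < x) (hα : α ≤ β - e x * p)
    (he : 0 < e x) (hδ : 0 ≤ δ) (hp : δ ≤ p) : α ≤ β - cutoff e x * δ := by
  have h1 := mul_le_mul_of_nonneg_right (cutoff_le (e := e) hx) hδ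
  have h2 := mul_le_mul_of_nonneg_left hp he.le
  linarith

theorem exists_rate_ind (d : ℕ) : ∃ e : ℝ → ℝ, ContinuousOn e (Set.Ioi 0) ∧
    (∀ x, 0 < x → 0 < e x) ∧ (1 ≤ d → ∀ (V : Type*) [Fintype V] [Nonempty V] (G : SimpleGraph V),
      (∀ v, (nb G v).card = d) → ∀ lam, 0 < lam →
        alphaInd G lam ≤ alphaInd (Kdd d) lam - e lam * (badCount G / Fintype.card V)) := by
  rcases Nat.eq_zero_or_pos d with rfl | hd
  -- A dummy rate for `d = 0`, since the constants must be positive and continuous for every natural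
  -- `d`.
  · exact ⟨fun _ => 1, continuousOn_const, by simp, fun h => absurd h (by simp)⟩
  have hpos : ∀ x : ℝ, 0 < x → 0 < 2 * (1 + x) ^ d - 1 := fun x hx => by
    have : (1 : ℝ) ≤ (1 + x) ^ d := one_le_pow₀ (by linarith)
    linarith
  refine ⟨fun lam => lam ^ (d + 2) / (1 + lam) ^ (d * d + 2 * d + 3) /
    (d * (2 * (1 + lam) ^ d - 1)), ?_, fun x hx => ?_,
    fun _ V _ _ G hG lam hlam => alphaInd_le hd hG hlam.le⟩
  · refine ContinuousOn.div (ContinuousOn.div (by fun_prop) (by fun_prop) fun x hx => ?_)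
      (by fun_prop) fun x hx => ?_
    · have : (0 : ℝ) < x := hx
      positivity
    · have := hpos x hx
      positivity
  · have := hpos x hx
    positivity

theorem exists_rate_match (d : ℕ) : ∃ e : ℝ → ℝ, ContinuousOn e (Set.Ioi 0) ∧
    (∀ x, 0 < x → 0 < e x) ∧ (1 ≤ d → ∀ (V : Type*) [Fintype V] [Nonempty V] (G : SimpleGraph V),
      (∀ v, (nb G v).card = d) → ∀ lam, 0 < lam →
        alphaMatch G lam ≤ alphaMatch (Kdd d) lam - e lam * (badCount G / Fintype.card V)) := by
  rcases d with _ | n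
  · exact ⟨fun _ => 1, continuousOn_const, by simp, fun h => absurd h (by simp)⟩
  obtain ⟨ε, hεc, hε, hgap⟩ := exists_potential_gap n
  refine ⟨fun lam => lam * (lam / 2 * ε lam * (lam / (1 + lam) /
    (1 + lam) ^ ((2 * (n + 1) + 2) * (n + 1)))) /
        ((n + 1) * (1 + lam + lam * (n + chainMean n lam))), ?_, fun x hx => ?_,
    fun _ V _ _ G hG lam hlam => alphaMatch_le hG hlam (hε lam hlam) fun a ha => hgap a ha lam⟩
  · have hm := continuousOn_chainMean n
    have h1 : ContinuousOn (fun lam : ℝ => lam / (1 + lam) /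
        (1 + lam) ^ ((2 * (n + 1) + 2) * (n + 1))) (Set.Ioi 0) := by
      refine ContinuousOn.div (ContinuousOn.div (by fun_prop) (by fun_prop) fun x hx => ?_)
        (by fun_prop) fun x hx => ?_ <;>
      · have : (0 : ℝ) < x := hx
        positivity
    refine ContinuousOn.div (by fun_prop) (by fun_prop) fun x hx => ?_
    have := chainMean_nonneg n hx
    have : (0 : ℝ) < x := hx
    positivity
  · have := chainMean_nonneg n hx
    have := hε x hx
    positivity

theorem alphaInd_zero {V : Type*} [Fintype V] (G : SimpleGraph V) : alphaInd G 0 = 0 := by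
  unfold alphaInd
  rw [Finset.sum_eq_zero, mul_zero]
  intro I _
  rcases Nat.eq_zero_or_pos I.card with h | h
  · simp [h]
  · simp [h.ne']

theorem alphaMatch_zero {V : Type*} [Fintype V] (G : SimpleGraph V) : alphaMatch G 0 = 0 := by
  unfold alphaMatch
  rw [Finset.sum_eq_zero, mul_zero]
  intro M _
  rcases Nat.eq_zero_or_pos M.card with h | h
  · simp [h]
  · simp [h.ne']

end Constants

end OccStability

theorem proposition9 :
    ∃ cMatch cInd : ℕ → ℝ → ℝ,
      (∀ d : ℕ, ContinuousOn (cMatch d) (Set.Ici 0) ∧ ContinuousOn (cInd d) (Set.Ici 0)) ∧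
      (∀ (d : ℕ) (lam : ℝ), 0 ≤ lam → 0 ≤ cMatch d lam ∧ 0 ≤ cInd d lam) ∧
      (∀ (d : ℕ) (lam : ℝ), 0 < lam → 0 < cMatch d lam ∧ 0 < cInd d lam) ∧
      ∀ (d : ℕ), 1 ≤ d → ∀ (V : Type*) [Fintype V] [Nonempty V] (G : SimpleGraph V)
        [G.LocallyFinite], G.IsRegularOfDegree d → ∀ lam : ℝ, 0 ≤ lam →
          OccStability.alphaMatch G lam ≤
            OccStability.alphaMatch (OccStability.Kdd d) lam -
              cMatch d lam * OccStability.samplingDist G (OccStability.Kdd d) ∧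
          OccStability.alphaInd G lam ≤
            OccStability.alphaInd (OccStability.Kdd d) lam -
              cInd d lam * OccStability.samplingDist G (OccStability.Kdd d) := by
  choose eM hMc hMp hM using OccStability.exists_rate_match
  choose eI hIc hIp hI using OccStability.exists_rate_ind
  refine ⟨fun d => OccStability.cutoff (eM d), fun d => OccStability.cutoff (eI d),
    fun d => ⟨OccStability.continuousOn_cutoff (hMp d) (hMc d),
      OccStability.continuousOn_cutoff (hIp d) (hIc d)⟩,
    fun d lam _ => ⟨OccStability.cutoff_nonneg (hMp d) lam, OccStability.cutoff_nonneg (hIp d) lam⟩,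
    fun d lam h => ⟨OccStability.cutoff_pos (hMp d) h, OccStability.cutoff_pos (hIp d) h⟩, ?_⟩
  intro d hd V _ _ G _ hreg lam hlam
  have hG := OccStability.card_nb hreg
  rcases hlam.eq_or_lt with rfl | hlam
  -- At zero fugacity the occupancy fractions and the cutoff constants all vanish.
  · simp [OccStability.alphaInd_zero, OccStability.alphaMatch_zero, OccStability.cutoff]
  · have hδ := OccStability.samplingDist_nonneg G (OccStability.Kdd d)
    have hp := OccStability.samplingDist_le hd hG
    exact ⟨OccStability.le_sub_cutoff_mul hlam (hM d hd V G hG lam hlam) (hMp d lam hlam) hδ hp,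
      OccStability.le_sub_cutoff_mul hlam (hI d hd V G hG lam hlam) (hIp d lam hlam) hδ hp⟩
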